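/- Let $T>0$ and let $(W^1_t,W^2_t)_{t\in[0,T]}$ be a two-dimensional standard Brownian motion, let $V_0$ be a centred normal random variable (possibly degenerate) independent of $(W^1,W^2)$, and let $\sigma\in L^2([0,T])$ be deterministic. Let $V$ be the process with continuous paths given by $$V_t=V_0+\int_0^t\sigma_s\,dW^1_s,\qquad 0\le t\le T$$ (a Wiener integral). Assume that $\mathrm{Var}(V_T)=T$ (in particular, $\mathrm{Var}(V_T)=1$ when $T=1$) and that $$\int_0^t\frac{ds}{|\mathrm{Var}(V_s)-s|}<\infty\qquad\text{for all }0\le t<T,$$ where $1/0=\infty$. Then the equation $$B_t=W^2_t+\int_0^t\frac{V_s-B_s}{\mathrm{Var}(V_s)-s}\,ds,\qquad 0\le t\le T,$$ holding almost surely for all $t$ simultaneously, where the integral is an absolutely convergent Lebesgue integral for $t<T$ and $\int_0^T$ means the limit of $\int_0^t$ as $t\uparrow T$, has a solution $B=(B_t)_{t\in[0,T]}$, which is unique up to indistinguishability. This process $B$ is a standard Brownian motion on $[0,T]$, and $B_T=V_T$ almost surely. -/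

import Mathlib

open MeasureTheory ProbabilityTheory Filter Topology Set

/-- `X` is a standard Brownian motion on the time interval `[0, T]` under `P`: its
finite-dimensional laws at times of `[0, T]` are those of the standard Brownian motion, and almost
all of its paths are continuous on `[0, T]`. The values of `X` outside of `[0, T]` play no role. -/
structure IsBrownianOn {Ω : Type*} [MeasurableSpace Ω] (P : Measure Ω) (T : ℝ) (X : ℝ → Ω → ℝ) :
    Prop where
  hasLaw : ∀ I : Finset NNReal, (∀ t ∈ I, (t : ℝ) ≤ T) →
    HasLaw (fun ω (t : I) ↦ X ((t : NNReal) : ℝ) ω) (BrownianReal.projectiveFamily I) P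
  cont : ∀ᵐ ω ∂P, ContinuousOn (fun t ↦ X t ω) (Icc 0 T)

/-- A deterministic step function `∑ i, c i • 𝟙_(t i, t (i + 1)]` on `[0, t]`. -/
structure StepIntegrand (t : ℝ) where
  n : ℕ
  node : Fin (n + 1) → ℝ
  node_mono : Monotone node
  node_mem : ∀ i, node i ∈ Icc 0 t
  coeff : Fin n → ℝ

/-- The value of a step function at `s`. -/
noncomputable def StepIntegrand.eval {t : ℝ} (f : StepIntegrand t) (s : ℝ) : ℝ :=
  ∑ i : Fin f.n, (Ioc (f.node i.castSucc) (f.node i.succ)).indicator (fun _ ↦ f.coeff i) s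

/-- The elementary stochastic integral `∑ i, c i * (W (t (i + 1)) - W (t i))`. -/
def StepIntegrand.integral {Ω : Type*} {t : ℝ} (f : StepIntegrand t) (W : ℝ → Ω → ℝ) (ω : Ω) : ℝ :=
  ∑ i : Fin f.n, f.coeff i * (W (f.node i.succ) ω - W (f.node i.castSucc) ω)

/-- `Y` is (a version of) the Wiener integral `∫₀ᵗ σ_s dW_s` of the deterministic function `σ`:
the `L²(P)` limit of the elementary integrals of step functions that converge to `σ` in
`L²((0, t])`. -/
def IsWienerIntegral {Ω : Type*} [MeasurableSpace Ω] (P : Measure Ω) (W : ℝ → Ω → ℝ)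
    (σ : ℝ → ℝ) (t : ℝ) (Y : Ω → ℝ) : Prop :=
  MemLp Y 2 P ∧ ∃ f : ℕ → StepIntegrand t,
    Tendsto (fun k ↦ eLpNorm (fun s ↦ (f k).eval s - σ s) 2 (volume.restrict (Ioc 0 t)))
      atTop (𝓝 0) ∧
    Tendsto (fun k ↦ eLpNorm (fun ω ↦ (f k).integral W ω - Y ω) 2 P) atTop (𝓝 0)

/-- The path `b` solves `b t = w t + ∫₀ᵗ (x s - b s) / (v s - s) ds` for all `0 ≤ t ≤ T`, where the
integral is a Lebesgue integral for `t < T`, and `∫₀ᵀ` is the limit of `∫₀ᵗ` as `t ↑ T`. -/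
structure IsSolutionPath (T : ℝ) (v x w b : ℝ → ℝ) : Prop where
  integrable : ∀ t ∈ Ico 0 T,
    IntervalIntegrable (fun s ↦ (x s - b s) / (v s - s)) volume 0 t
  eq_of_lt : ∀ t ∈ Ico 0 T, b t = w t + ∫ s in (0 : ℝ)..t, (x s - b s) / (v s - s)
  eq_end : Tendsto (fun t ↦ w T + ∫ s in (0 : ℝ)..t, (x s - b s) / (v s - s)) (𝓝[<] T) (𝓝 (b T))

/-- Almost surely, the path of `B` solves
`B_t = W_t + ∫₀ᵗ (V_s - B_s) / (Var(V_s) - s) ds` for all `0 ≤ t ≤ T`. -/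
def IsSolution {Ω : Type*} [MeasurableSpace Ω] (P : Measure Ω) (T : ℝ) (V W B : ℝ → Ω → ℝ) : Prop :=
  ∀ᵐ ω ∂P, IsSolutionPath T (fun s ↦ Var[V s; P]) (fun s ↦ V s ω) (fun s ↦ W s ω) (fun s ↦ B s ω)

/-!
Put `h s = Var(V_s) - s`. Since `h s + s` is nondecreasing, `h` can fall at most at unit speed, so a
zero of `h` or a change of its sign before `T` would make `∫ ds / |h s|` diverge; hence `h > 0` on
`(0, T)`, and also `h s ≤ T - s`. Path by path, `u = B - W²` then solves the linear equation
`u' = (V - W² - u) / h`, `u 0 = 0`, whose only solution is an average of the past of `V - W²` with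
weights `d exp (∫ ds / h)`. As `∫ ds / h` diverges at `T`, this average tends to `V_T - W²_T`.

The same formula, read in `L²`, shows that `B` stays in the closed Gaussian space of `W¹`, `W²`,
`V_0`, so that only its covariance matters. With `a` the average of `s` in place of `V_s - W²_s`,
the drift `A` satisfies `⟪V_t, A_s⟫ = s` and `⟪W²_t, A_s⟫ = -a s` for `s ≤ t`, hence
`‖A_s‖² = 2 a s`, since both sides satisfy the same differential equation, and `⟪B_s, B_t⟫ = s`.
-/

/-! ### The pathwise linear equation -/

section Positivity

variable {h : ℝ → ℝ} {a t T : ℝ}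

lemma lintegral_enorm_inv_eq_top {c : ℝ} (hat : a < t) (hc : c ∈ Icc a t)
    (hle : ∀ s ∈ Ioc a t, |h s| ≤ |s - c|) : ∫⁻ s in Ioc a t, ‖h s‖ₑ⁻¹ = ⊤ := by
  have hnot : ¬ IntervalIntegrable (fun s ↦ (s - c)⁻¹) volume a t := by
    rw [intervalIntegrable_sub_inv_iff, uIcc_of_le hat.le]
    exact not_or.2 ⟨hat.ne, not_not.2 hc⟩
  by_contra hne
  refine hnot ((intervalIntegrable_iff_integrableOn_Ioc_of_le hat.le).2
    ⟨(by fun_prop : Measurable fun s : ℝ ↦ (s - c)⁻¹).aestronglyMeasurable, ?_⟩)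
  refine lt_of_le_of_lt (setLIntegral_mono_ae' measurableSet_Ioc (ae_of_all _ fun s hs ↦ ?_))
    (lt_top_iff_ne_top.2 hne)
  rcases eq_or_ne s c with rfl | hsc
  · simp
  · rw [enorm_inv (sub_ne_zero.2 hsc), ENNReal.inv_le_inv, Real.enorm_eq_ofReal_abs,
      Real.enorm_eq_ofReal_abs]
    exact ENNReal.ofReal_le_ofReal (hle s hs)

lemma nonneg_of_lintegral_enorm_inv_ne_top (hmono : MonotoneOn (fun s ↦ h s + s) (Icc a t))
    (hat : a ≤ t) (ha : 0 ≤ h a) (hint : ∫⁻ s in Ioc a t, ‖h s‖ₑ⁻¹ ≠ ⊤) : 0 ≤ h t := by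
  by_contra! hlt
  -- After the last time `c` at which `h` is nonnegative, `h` falls at most at unit speed.
  set Z : Set ℝ := {s ∈ Icc a t | 0 ≤ h s}
  set c : ℝ := sSup Z
  have haZ : a ∈ Z := ⟨⟨le_rfl, hat⟩, ha⟩
  have hZ : BddAbove Z := ⟨t, fun s hs ↦ hs.1.2⟩
  have hac : a ≤ c := le_csSup hZ haZ
  have hc_le : ∀ s ∈ Icc a t, c ≤ s → c ≤ h s + s := fun s hs hcs ↦
    csSup_le ⟨a, haZ⟩ fun z hz ↦
      (le_add_of_nonneg_left hz.2).trans (hmono hz.1 hs ((le_csSup hZ hz).trans hcs))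
  have hct : c < t := by
    have := hc_le t ⟨hat, le_rfl⟩ (csSup_le ⟨a, haZ⟩ fun z hz ↦ hz.1.2)
    linarith
  have hbound : ∀ s ∈ Ioc c t, |h s| ≤ |s - c| := fun s hs ↦ by
    have hsI : s ∈ Icc a t := ⟨hac.trans hs.1.le, hs.2⟩
    have hneg : h s < 0 := not_le.1 fun h0 ↦ notMem_of_csSup_lt hs.1 hZ ⟨hsI, h0⟩
    rw [abs_of_neg hneg, abs_of_pos (sub_pos.2 hs.1)]
    linarith [hc_le s hsI hs.1.le]
  refine hint (top_unique ?_)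
  rw [← lintegral_enorm_inv_eq_top hct ⟨le_rfl, hct.le⟩ hbound]
  exact lintegral_mono_set (Ioc_subset_Ioc_left hac)

lemma pos_of_lintegral_enorm_inv_ne_top (hmono : MonotoneOn (fun s ↦ h s + s) (Icc a t))
    (hat : a < t) (ha : 0 ≤ h a) (hint : ∫⁻ s in Ioc a t, ‖h s‖ₑ⁻¹ ≠ ⊤) : 0 < h t := by
  have hnonneg : ∀ s ∈ Icc a t, 0 ≤ h s := fun s hs ↦
    nonneg_of_lintegral_enorm_inv_ne_top (hmono.mono (Icc_subset_Icc_right hs.2)) hs.1 ha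
      (ne_top_of_le_ne_top hint (lintegral_mono_set (Ioc_subset_Ioc_right hs.2)))
  refine lt_of_le_of_ne (hnonneg t ⟨hat.le, le_rfl⟩) fun hzero ↦ hint ?_
  refine lintegral_enorm_inv_eq_top hat ⟨hat.le, le_rfl⟩ fun s hs ↦ ?_
  have hmono_s := hmono ⟨hs.1.le, hs.2⟩ ⟨hat.le, le_rfl⟩ hs.2
  rw [abs_of_nonneg (hnonneg s ⟨hs.1.le, hs.2⟩), abs_sub_comm, abs_of_nonneg (sub_nonneg.2 hs.2)]
  linarith

end Positivity

section Primitive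

variable {E : Type*} [NormedAddCommGroup E] [NormedSpace ℝ E] {f : ℝ → E} {a t T : ℝ}

lemma hasDerivAt_integral_of_mem_Ioo [CompleteSpace E]
    (hf : ∀ s ∈ Ico a T, IntervalIntegrable f volume a s) (hc : ContinuousAt f t)
    (ht : t ∈ Ioo a T) : HasDerivAt (fun t ↦ ∫ s in a..t, f s) (f t) t := by
  obtain ⟨s, hts, hsT⟩ := exists_between ht.2
  have hfs := (hf s ⟨(ht.1.trans hts).le, hsT⟩).1
  exact intervalIntegral.integral_hasDerivAt_right (hf t ⟨ht.1.le, ht.2⟩)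
    ⟨Ioc a s, Ioc_mem_nhds ht.1 hts, hfs.aestronglyMeasurable⟩ hc

lemma continuousOn_integral_Ico (hf : ∀ s ∈ Ico a T, IntervalIntegrable f volume a s) :
    ContinuousOn (fun t ↦ ∫ s in a..t, f s) (Ico a T) := by
  intro t ht
  obtain ⟨s, hts, hsT⟩ := exists_between ht.2
  have has : a ≤ s := ht.1.trans hts.le
  have hcont := intervalIntegral.continuousOn_primitive_interval (μ := volume) (f := f)
    ((intervalIntegrable_iff' (by simp)).1 (hf s ⟨has, hsT⟩))
  rw [uIcc_of_le has] at hcont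
  refine (hcont t ⟨ht.1, hts.le⟩).mono_of_mem_nhdsWithin ?_
  filter_upwards [self_mem_nhdsWithin, mem_nhdsWithin_of_mem_nhds (Iic_mem_nhds hts)]
    with r hr hrs using ⟨hr.1, hrs⟩

end Primitive

/-- The conditions on `h` under which `u' = (y - u) / h`, `u 0 = 0`, has on `[0, T)` a unique
solution, which moreover tends to `y T` at `T`. -/
structure IsBridgeRate (T : ℝ) (h : ℝ → ℝ) : Prop where
  pos_T : 0 < T
  cont : ContinuousOn h (Ioo 0 T)
  pos : ∀ t ∈ Ioo 0 T, 0 < h t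
  le : ∀ t ∈ Ioo 0 T, h t ≤ T - t
  intervalIntegrable_inv : ∀ t ∈ Ico 0 T, IntervalIntegrable (fun s ↦ (h s)⁻¹) volume 0 t

namespace IsBridgeRate

section Factor

variable {T : ℝ} {h : ℝ → ℝ}

lemma of_monotoneOn_add_id (hT : 0 < T) (hc : ContinuousOn h (Ioo 0 T))
    (hmono : MonotoneOn (fun s ↦ h s + s) (Icc 0 T)) (h0 : 0 ≤ h 0) (hhT : h T = 0)
    (hint : ∀ t ∈ Ico 0 T, ∫⁻ s in Ioc 0 t, ‖h s‖ₑ⁻¹ ≠ ⊤) : IsBridgeRate T h where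
  pos_T := hT
  cont := hc
  pos t ht := pos_of_lintegral_enorm_inv_ne_top (hmono.mono (Icc_subset_Icc_right ht.2.le)) ht.1 h0
    (hint t ⟨ht.1.le, ht.2⟩)
  le t ht := by
    have := hmono ⟨ht.1.le, ht.2.le⟩ ⟨hT.le, le_rfl⟩ ht.2.le
    linarith
  intervalIntegrable_inv t ht := by
    have hcont : ContinuousOn h (Ioc 0 t) := hc.mono (Ioc_subset_Ioo_right ht.2)
    refine (intervalIntegrable_iff_integrableOn_Ioc_of_le ht.1).2
      ⟨(hcont.aemeasurable measurableSet_Ioc).inv.aestronglyMeasurable, ?_⟩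
    refine lt_of_le_of_lt (setLIntegral_mono_ae' measurableSet_Ioc (ae_of_all _ fun s _ ↦ ?_))
      (lt_top_iff_ne_top.2 (hint t ht))
    rcases eq_or_ne (h s) 0 with hs | hs
    · simp [hs]
    · exact (enorm_inv hs).le

lemma div_two (H : IsBridgeRate T h) : IsBridgeRate T (fun t ↦ h t / 2) where
  pos_T := H.pos_T
  cont := H.cont.div_const 2
  pos t ht := half_pos (H.pos t ht)
  le t ht := (half_le_self (H.pos t ht).le).trans (H.le t ht)
  intervalIntegrable_inv t ht := by
    simpa only [inv_div, div_eq_mul_inv (2 : ℝ)] using (H.intervalIntegrable_inv t ht).const_mul 2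

lemma continuousAt (H : IsBridgeRate T h) {t : ℝ} (ht : t ∈ Ioo 0 T) : ContinuousAt h t :=
  H.cont.continuousAt (Ioo_mem_nhds ht.1 ht.2)

/-- The integrating factor `exp (∫₀ᵗ ds / h s)`. -/
noncomputable def factor (h : ℝ → ℝ) (t : ℝ) : ℝ := Real.exp (∫ s in (0 : ℝ)..t, (h s)⁻¹)

/-- The derivative of the integrating factor. -/
noncomputable def weight (h : ℝ → ℝ) (t : ℝ) : ℝ := factor h t * (h t)⁻¹

lemma factor_pos (t : ℝ) : 0 < factor h t := Real.exp_pos _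

lemma continuousOn_factor (H : IsBridgeRate T h) : ContinuousOn (factor h) (Ico 0 T) :=
  Real.continuous_exp.comp_continuousOn (continuousOn_integral_Ico H.intervalIntegrable_inv)

lemma hasDerivAt_factor (H : IsBridgeRate T h) {t : ℝ} (ht : t ∈ Ioo 0 T) :
    HasDerivAt (factor h) (weight h t) t :=
  (hasDerivAt_integral_of_mem_Ioo H.intervalIntegrable_inv
    ((H.continuousAt ht).inv₀ (H.pos t ht).ne') ht).exp

lemma weight_nonneg (H : IsBridgeRate T h) {t : ℝ} (ht : t ∈ Ioo 0 T) : 0 ≤ weight h t :=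
  mul_nonneg (factor_pos t).le (inv_nonneg.2 (H.pos t ht).le)

lemma continuousAt_weight (H : IsBridgeRate T h) {t : ℝ} (ht : t ∈ Ioo 0 T) :
    ContinuousAt (weight h) t :=
  (H.hasDerivAt_factor ht).continuousAt.mul ((H.continuousAt ht).inv₀ (H.pos t ht).ne')

lemma intervalIntegrable_weight (H : IsBridgeRate T h) {t : ℝ} (ht : t ∈ Ico 0 T) :
    IntervalIntegrable (weight h) volume 0 t := by
  refine (H.intervalIntegrable_inv t ht).continuousOn_mul (H.continuousOn_factor.mono ?_)
  rw [uIcc_of_le ht.1]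
  exact Icc_subset_Ico_right ht.2

lemma integral_weight (H : IsBridgeRate T h) {s t : ℝ} (hs : 0 ≤ s) (hst : s ≤ t) (ht : t < T) :
    ∫ r in s..t, weight h r = factor h t - factor h s :=
  intervalIntegral.integral_eq_sub_of_hasDerivAt_of_le hst
    (H.continuousOn_factor.mono fun _ hr ↦ ⟨hs.trans hr.1, hr.2.trans_lt ht⟩)
    (fun _ hr ↦ H.hasDerivAt_factor ⟨hs.trans_lt hr.1, hr.2.trans ht⟩)
    ((H.intervalIntegrable_weight ⟨hs, hst.trans_lt ht⟩).symm.trans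
      (H.intervalIntegrable_weight ⟨hs.trans hst, ht⟩))

lemma tendsto_factor (H : IsBridgeRate T h) : Tendsto (factor h) (𝓝[<] T) atTop := by
  have hdiv : Tendsto (fun t ↦ T / (T - t)) (𝓝[<] T) atTop := by
    refine Tendsto.const_mul_atTop H.pos_T (tendsto_inv_nhdsGT_zero.comp ?_)
    refine tendsto_nhdsWithin_iff.2 ⟨?_, ?_⟩
    · exact (Continuous.tendsto' (by fun_prop) T 0 (sub_self T)).mono_left nhdsWithin_le_nhds
    · filter_upwards [self_mem_nhdsWithin] with t ht using sub_pos.2 (mem_Iio.1 ht)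
  refine tendsto_atTop_mono' _ ?_ hdiv
  filter_upwards [Ioo_mem_nhdsLT H.pos_T] with t ht
  have hTt : 0 < T - t := sub_pos.2 ht.2
  have hlog : ∫ s in (0 : ℝ)..t, (T - s)⁻¹ = Real.log (T / (T - t)) := by
    rw [intervalIntegral.integral_comp_sub_left (fun s ↦ s⁻¹) T, sub_zero,
      integral_inv_of_pos hTt H.pos_T]
  rw [factor, ← Real.log_le_iff_le_exp (div_pos H.pos_T hTt), ← hlog]
  refine intervalIntegral.integral_mono_on_of_le_Ioo ht.1.le ?_
    (H.intervalIntegrable_inv t ⟨ht.1.le, ht.2⟩) fun s hs ↦ ?_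
  · refine ContinuousOn.intervalIntegrable (ContinuousOn.inv₀ (by fun_prop) fun s hs ↦ ?_)
    rw [uIcc_of_le ht.1.le] at hs
    exact (sub_pos.2 (hs.2.trans_lt ht.2)).ne'
  · have hs' : s ∈ Ioo 0 T := ⟨hs.1, hs.2.trans ht.2⟩
    exact inv_anti₀ (H.pos s hs') (H.le s hs')

end Factor

section WeightedAverage

variable {E F : Type*} [NormedAddCommGroup E] [NormedSpace ℝ E] [NormedAddCommGroup F]
  [NormedSpace ℝ F] {T s t : ℝ} {h : ℝ → ℝ} {y u : ℝ → E}

/-- The solution of `u' = (y - u) / h`, `u 0 = 0`, a weighted average of `y`. It is used for single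
paths (`E = ℝ`) and for processes, as curves in `L²`. -/
noncomputable def weightedAverage (h : ℝ → ℝ) (y : ℝ → E) (t : ℝ) : E :=
  (factor h t)⁻¹ • ∫ s in (0 : ℝ)..t, weight h s • y s

lemma weightedAverage_zero : weightedAverage h y 0 = 0 := by simp [weightedAverage]

lemma weightedAverage_congr {y' : ℝ → E} (ht : 0 ≤ t) (hy : EqOn y y' (Icc 0 t)) :
    weightedAverage h y t = weightedAverage h y' t := by
  rw [weightedAverage, weightedAverage, intervalIntegral.integral_congr fun s hs ↦ ?_]
  rw [uIcc_of_le ht] at hs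
  rw [hy hs]

lemma intervalIntegrable_weight_smul (H : IsBridgeRate T h) (hy : ContinuousOn y (Ico 0 T))
    (ht : t ∈ Ico 0 T) : IntervalIntegrable (fun s ↦ weight h s • y s) volume 0 t := by
  refine (H.intervalIntegrable_weight ht).smul_continuousOn (hy.mono ?_)
  rw [uIcc_of_le ht.1]
  exact Icc_subset_Ico_right ht.2

lemma map_weightedAverage [CompleteSpace E] [CompleteSpace F] (H : IsBridgeRate T h)
    (hy : ContinuousOn y (Ico 0 T)) (L : E →L[ℝ] F) (ht : t ∈ Ico 0 T) :
    L (weightedAverage h y t) = weightedAverage h (fun s ↦ L (y s)) t := by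
  simp only [weightedAverage, map_smul]
  rw [← L.intervalIntegral_comp_comm (H.intervalIntegrable_weight_smul hy ht)]
  simp only [map_smul]

lemma continuousOn_weightedAverage (H : IsBridgeRate T h) (hy : ContinuousOn y (Ico 0 T)) :
    ContinuousOn (weightedAverage h y) (Ico 0 T) :=
  (H.continuousOn_factor.inv₀ fun s _ ↦ (factor_pos s).ne').smul
    (continuousOn_integral_Ico fun _ ht ↦ H.intervalIntegrable_weight_smul hy ht)

lemma hasDerivAt_weightedAverage [CompleteSpace E] (H : IsBridgeRate T h)
    (hy : ContinuousOn y (Ico 0 T)) (ht : t ∈ Ioo 0 T) :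
    HasDerivAt (weightedAverage h y) ((h t)⁻¹ • (y t - weightedAverage h y t)) t := by
  have hfactor := (H.hasDerivAt_factor ht).inv (factor_pos t).ne'
  have hintegral := hasDerivAt_integral_of_mem_Ioo
    (fun s hs ↦ H.intervalIntegrable_weight_smul hy hs)
    ((H.continuousAt_weight ht).smul (hy.continuousAt (Ico_mem_nhds ht.1 ht.2))) ht
  refine (hfactor.smul hintegral).congr_deriv ?_
  have hψ := (factor_pos (h := h) t).ne'
  simp only [Pi.inv_apply, weightedAverage, weight]
  match_scalars <;> field_simp

/-- The fundamental theorem of calculus for `factor h • u`. -/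
lemma eqOn_weightedAverage [CompleteSpace E] (H : IsBridgeRate T h) (hy : ContinuousOn y (Ico 0 T))
    (hu0 : u 0 = 0) (hu : ContinuousOn u (Ico 0 T))
    (hu' : ∀ t ∈ Ioo 0 T, HasDerivAt u ((h t)⁻¹ • (y t - u t)) t) :
    EqOn u (weightedAverage h y) (Ico 0 T) := by
  intro t ht
  have hsub : Icc 0 t ⊆ Ico 0 T := Icc_subset_Ico_right ht.2
  have hintegral : ∫ s in (0 : ℝ)..t, weight h s • y s = factor h t • u t - factor h 0 • u 0 := by
    refine intervalIntegral.integral_eq_sub_of_hasDerivAt_of_le ht.1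
      ((H.continuousOn_factor.mono hsub).smul (hu.mono hsub)) (fun s hs ↦ ?_)
      (H.intervalIntegrable_weight_smul hy ht)
    have hs' : s ∈ Ioo 0 T := ⟨hs.1, hs.2.trans ht.2⟩
    refine ((H.hasDerivAt_factor hs').smul (hu' s hs')).congr_deriv ?_
    simp only [weight]
    module
  rw [weightedAverage, hintegral, hu0, smul_zero, sub_zero, inv_smul_smul₀ (factor_pos t).ne']

lemma weightedAverage_add_id (H : IsBridgeRate T h) (hc : ContinuousOn h (Ico 0 T))
    (ht : t ∈ Ico 0 T) : weightedAverage h (fun s ↦ h s + s) t = t := by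
  refine (H.eqOn_weightedAverage (u := id) (hc.add continuousOn_id) rfl continuousOn_id
    (fun s hs ↦ ?_) ht).symm
  simpa [(H.pos s hs).ne'] using hasDerivAt_id s

lemma integral_inv_smul_sub_weightedAverage [CompleteSpace E] (H : IsBridgeRate T h)
    (hy : ContinuousOn y (Ico 0 T)) (ht : t ∈ Ico 0 T) :
    ∫ s in (0 : ℝ)..t, (h s)⁻¹ • (y s - weightedAverage h y s) = weightedAverage h y t := by
  have hsub : Icc 0 t ⊆ Ico 0 T := Icc_subset_Ico_right ht.2
  rw [intervalIntegral.integral_eq_sub_of_hasDerivAt_of_le ht.1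
    ((H.continuousOn_weightedAverage hy).mono hsub)
    (fun s hs ↦ H.hasDerivAt_weightedAverage hy ⟨hs.1, hs.2.trans ht.2⟩)
    ((H.intervalIntegrable_inv t ht).smul_continuousOn ?_), weightedAverage_zero, sub_zero]
  rw [uIcc_of_le ht.1]
  exact (hy.sub (H.continuousOn_weightedAverage hy)).mono hsub

lemma weightedAverage_sub_eq [CompleteSpace E] (H : IsBridgeRate T h)
    (hy : ContinuousOn y (Ico 0 T)) (hs : 0 ≤ s) (hst : s ≤ t) (ht : t < T) (c : E) :
    weightedAverage h y t - c = (factor h t)⁻¹ •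
      (factor h s • (weightedAverage h y s - c) + ∫ r in s..t, weight h r • (y r - c)) := by
  have hsI : s ∈ Ico 0 T := ⟨hs, hst.trans_lt ht⟩
  have htI : t ∈ Ico 0 T := ⟨hs.trans hst, ht⟩
  have hws := H.intervalIntegrable_weight_smul hy hsI
  have hwst := hws.symm.trans (H.intervalIntegrable_weight_smul hy htI)
  have hcst := ((H.intervalIntegrable_weight hsI).symm.trans
    (H.intervalIntegrable_weight htI)).smul_continuousOn (g := fun _ ↦ c) continuousOn_const
  simp only [weightedAverage, smul_sub]
  rw [intervalIntegral.integral_sub hwst hcst, intervalIntegral.integral_smul_const,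
    H.integral_weight hs hst ht, ← intervalIntegral.integral_add_adjacent_intervals hws hwst]
  have hψs := (factor_pos (h := h) s).ne'
  have hψt := (factor_pos (h := h) t).ne'
  match_scalars <;> field_simp
  ring

lemma weightedAverage_eq_of_forall_eq [CompleteSpace E] (H : IsBridgeRate T h)
    (hy : ContinuousOn y (Ico 0 T)) (hs : 0 ≤ s) (hst : s ≤ t) (ht : t < T) {c : E}
    (hsc : weightedAverage h y s = c) (hyc : ∀ r ∈ Icc s t, y r = c) :
    weightedAverage h y t = c := by
  have hzero : ∫ r in s..t, weight h r • (y r - c) = ∫ _ in s..t, (0 : E) :=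
    intervalIntegral.integral_congr fun r hr ↦ by
      rw [uIcc_of_le hst] at hr
      simp [hyc r hr]
  rw [← sub_eq_zero, H.weightedAverage_sub_eq hy hs hst ht, hsc, hzero]
  simp

lemma norm_weightedAverage_sub_le [CompleteSpace E] (H : IsBridgeRate T h)
    (hy : ContinuousOn y (Ico 0 T)) (hs : 0 ≤ s) (hst : s ≤ t) (ht : t < T) {c : E} {ε : ℝ}
    (hyc : ∀ r ∈ Ioc s t, ‖y r - c‖ ≤ ε) (hε : 0 ≤ ε) :
    ‖weightedAverage h y t - c‖ ≤
      (factor h t)⁻¹ * (factor h s * ‖weightedAverage h y s - c‖) + ε := by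
  have hψs := factor_pos (h := h) s
  have hψt := factor_pos (h := h) t
  have hsI : s ∈ Ico 0 T := ⟨hs, hst.trans_lt ht⟩
  have hrest : ‖∫ r in s..t, weight h r • (y r - c)‖ ≤ factor h t * ε := by
    calc ‖∫ r in s..t, weight h r • (y r - c)‖
        ≤ ∫ r in s..t, weight h r * ε := by
          refine intervalIntegral.norm_integral_le_of_norm_le hst (ae_of_all _ fun r hr ↦ ?_)
            (((H.intervalIntegrable_weight hsI).symm.trans
              (H.intervalIntegrable_weight ⟨hs.trans hst, ht⟩)).mul_const ε)
          have hr0 := H.weight_nonneg ⟨hs.trans_lt hr.1, hr.2.trans_lt ht⟩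
          rw [norm_smul, Real.norm_of_nonneg hr0]
          exact mul_le_mul_of_nonneg_left (hyc r hr) hr0
      _ = (factor h t - factor h s) * ε := by
          rw [intervalIntegral.integral_mul_const, H.integral_weight hs hst ht]
      _ ≤ factor h t * ε := by gcongr; linarith
  rw [H.weightedAverage_sub_eq hy hs hst ht, norm_smul, norm_inv, Real.norm_of_nonneg hψt.le]
  calc _ ≤ (factor h t)⁻¹ * (factor h s * ‖weightedAverage h y s - c‖ + factor h t * ε) := by
        gcongr
        refine (norm_add_le _ _).trans (add_le_add (le_of_eq ?_) hrest)
        rw [norm_smul, Real.norm_of_nonneg hψs.le]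
    _ = _ := by field_simp

lemma tendsto_weightedAverage [CompleteSpace E] (H : IsBridgeRate T h)
    (hy : ContinuousOn y (Icc 0 T)) : Tendsto (weightedAverage h y) (𝓝[<] T) (𝓝 (y T)) := by
  rw [Metric.tendsto_nhds]
  intro ε hε
  obtain ⟨δ, hδ, hyδ⟩ := Metric.continuousWithinAt_iff.1 (hy T ⟨H.pos_T.le, le_rfl⟩) (ε / 2)
    (half_pos hε)
  obtain ⟨s, hs, hsT⟩ := exists_between (max_lt H.pos_T (sub_lt_self T hδ))
  obtain ⟨hs0, hsδ⟩ := max_lt_iff.1 hs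
  have hforget : Tendsto (fun t ↦ (factor h t)⁻¹ * (factor h s * ‖weightedAverage h y s - y T‖))
      (𝓝[<] T) (𝓝 0) := by
    simpa using (tendsto_inv_atTop_zero.comp H.tendsto_factor).mul_const
      (factor h s * ‖weightedAverage h y s - y T‖)
  filter_upwards [hforget.eventually_lt_const (half_pos hε), Ioo_mem_nhdsLT hsT] with t ht hst
  have hclose : ∀ r ∈ Ioc s t, ‖y r - y T‖ ≤ ε / 2 := fun r hr ↦ by
    rw [← dist_eq_norm]
    refine (hyδ ⟨hs0.le.trans hr.1.le, hr.2.trans hst.2.le⟩ ?_).le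
    rw [Real.dist_eq, abs_lt]
    constructor <;> linarith [hr.1, hr.2, hst.2]
  have := H.norm_weightedAverage_sub_le (hy.mono Ico_subset_Icc_self) hs0.le hst.1.le hst.2 hclose
    (half_pos hε).le
  rw [dist_eq_norm]
  linarith

end WeightedAverage

end IsBridgeRate

section Bridge

open IsBridgeRate

variable {E : Type*} [NormedAddCommGroup E] [NormedSpace ℝ E] {T t : ℝ} {h : ℝ → ℝ}

/-- The solution of `b t = w t + ∫₀ᵗ (x s - b s) / h s ds` on `[0, T]`, continued by its limit `x T`
at `T`. -/
noncomputable def bridge (T : ℝ) (h : ℝ → ℝ) (w x : ℝ → E) (t : ℝ) : E :=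
  if t < T then w t + weightedAverage h (fun s ↦ x s - w s) t else x t

lemma bridge_of_lt {w x : ℝ → E} (ht : t < T) :
    bridge T h w x t = w t + weightedAverage h (fun s ↦ x s - w s) t := if_pos ht

lemma bridge_self {w x : ℝ → E} : bridge T h w x T = x T := if_neg (lt_irrefl T)

namespace IsBridgeRate

lemma tendsto_bridge [CompleteSpace E] (H : IsBridgeRate T h) {w x : ℝ → E}
    (hw : ContinuousOn w (Icc 0 T)) (hx : ContinuousOn x (Icc 0 T)) :
    Tendsto (bridge T h w x) (𝓝[<] T) (𝓝 (x T)) := by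
  have hwT : Tendsto w (𝓝[<] T) (𝓝 (w T)) := by
    rw [← nhdsWithin_Ioo_eq_nhdsLT H.pos_T]
    exact (hw T ⟨H.pos_T.le, le_rfl⟩).mono_left (nhdsWithin_mono T Ioo_subset_Icc_self)
  have hsum := hwT.add (H.tendsto_weightedAverage (hx.sub hw))
  rw [Pi.sub_apply, add_sub_cancel] at hsum
  exact hsum.congr' (by filter_upwards [self_mem_nhdsWithin] with t ht using (bridge_of_lt ht).symm)

lemma continuousOn_bridge [CompleteSpace E] (H : IsBridgeRate T h) {w x : ℝ → E}
    (hw : ContinuousOn w (Icc 0 T)) (hx : ContinuousOn x (Icc 0 T)) :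
    ContinuousOn (bridge T h w x) (Icc 0 T) := by
  have hIco : ContinuousOn (bridge T h w x) (Ico 0 T) :=
    ((hw.mono Ico_subset_Icc_self).add
      (H.continuousOn_weightedAverage ((hx.sub hw).mono Ico_subset_Icc_self))).congr
      fun t ht ↦ bridge_of_lt ht.2
  intro t ht
  rcases ht.2.lt_or_eq with htT | rfl
  · refine (hIco t ⟨ht.1, htT⟩).mono_of_mem_nhdsWithin ?_
    filter_upwards [self_mem_nhdsWithin, mem_nhdsWithin_of_mem_nhds (Iio_mem_nhds htT)]
      with s hs hsT using ⟨hs.1, hsT⟩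
  · have hlim := H.tendsto_bridge hw hx
    rw [← bridge_self (h := h) (w := w) (x := x)] at hlim
    rw [← Ico_insert_right ht.1, continuousWithinAt_insert_self]
    exact hlim.mono_left (nhdsWithin_mono t fun _ hs ↦ hs.2)

end IsBridgeRate

end Bridge

namespace IsSolutionPath

variable {T : ℝ} {v w x b : ℝ → ℝ}

lemma eqOn_weightedAverage (H : IsBridgeRate T (fun s ↦ v s - s)) (hw : ContinuousOn w (Icc 0 T))
    (hx : ContinuousOn x (Icc 0 T)) (hb : IsSolutionPath T v x w b) :
    EqOn (fun t ↦ b t - w t) (IsBridgeRate.weightedAverage (fun s ↦ v s - s) fun s ↦ x s - w s)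
      (Ico 0 T) := by
  have heq : ∀ t ∈ Ico 0 T, b t - w t = ∫ s in (0 : ℝ)..t, (x s - b s) / (v s - s) := fun t ht ↦
    sub_eq_of_eq_add' (hb.eq_of_lt t ht)
  have hu : ContinuousOn (fun t ↦ b t - w t) (Ico 0 T) :=
    (continuousOn_integral_Ico hb.integrable).congr heq
  refine H.eqOn_weightedAverage ((hx.sub hw).mono Ico_subset_Icc_self)
    (by simpa using heq 0 ⟨le_rfl, H.pos_T⟩) hu fun t ht ↦ ?_
  have hbt : ContinuousAt b t :=
    ((hu.continuousAt (Ico_mem_nhds ht.1 ht.2)).add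
      (hw.continuousAt (Icc_mem_nhds ht.1 ht.2))).congr
      (.of_forall fun s ↦ sub_add_cancel (b s) (w s))
  have hderiv := hasDerivAt_integral_of_mem_Ioo hb.integrable
    (((hx.continuousAt (Icc_mem_nhds ht.1 ht.2)).sub hbt).div₀ (H.continuousAt ht)
      (H.pos t ht).ne') ht
  refine (hderiv.congr_of_eventuallyEq ?_).congr_deriv ?_
  · filter_upwards [Ico_mem_nhds ht.1 ht.2] with s hs using heq s hs
  · rw [sub_sub_sub_cancel_right, smul_eq_mul, div_eq_inv_mul]

lemma eqOn_bridge (H : IsBridgeRate T (fun s ↦ v s - s)) (hw : ContinuousOn w (Icc 0 T))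
    (hx : ContinuousOn x (Icc 0 T)) (hb : IsSolutionPath T v x w b) :
    EqOn b (bridge T (fun s ↦ v s - s) w x) (Icc 0 T) := by
  have hlt : EqOn b (bridge T (fun s ↦ v s - s) w x) (Ico 0 T) := fun t ht ↦ by
    rw [bridge_of_lt ht.2, ← hb.eqOn_weightedAverage H hw hx ht, add_sub_cancel]
  intro t ht
  rcases ht.2.lt_or_eq with htT | rfl
  · exact hlt ⟨ht.1, htT⟩
  · rw [bridge_self]
    have hwt : Tendsto (fun s ↦ w t - w s) (𝓝[<] t) (𝓝 (w t - w t)) := by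
      rw [← nhdsWithin_Ioo_eq_nhdsLT H.pos_T]
      exact ((hw t ht).mono_left (nhdsWithin_mono t Ioo_subset_Icc_self)).const_sub (w t)
    have hlim := hwt.add (H.tendsto_bridge hw hx)
    rw [sub_self, zero_add] at hlim
    refine tendsto_nhds_unique (hb.eq_end.congr' ?_) hlim
    filter_upwards [Ioo_mem_nhdsLT H.pos_T] with s hs
    have hs' : s ∈ Ico 0 t := ⟨hs.1.le, hs.2⟩
    rw [← hlt hs', hb.eq_of_lt s hs']
    ring

lemma of_eqOn_bridge (H : IsBridgeRate T (fun s ↦ v s - s)) (hw : ContinuousOn w (Icc 0 T))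
    (hx : ContinuousOn x (Icc 0 T)) (hb : EqOn b (bridge T (fun s ↦ v s - s) w x) (Icc 0 T)) :
    IsSolutionPath T v x w b := by
  have hy : ContinuousOn (fun s ↦ x s - w s) (Icc 0 T) := hx.sub hw
  have hdrift : ∀ t ∈ Ico 0 T, EqOn (fun s ↦ (x s - b s) / (v s - s))
      (fun s ↦ (v s - s)⁻¹ • ((x s - w s) -
        IsBridgeRate.weightedAverage (fun s ↦ v s - s) (fun s ↦ x s - w s) s)) (uIcc 0 t) := by
    intro t ht s hs
    rw [uIcc_of_le ht.1] at hs
    simp only [hb ⟨hs.1, hs.2.trans ht.2.le⟩, bridge_of_lt (hs.2.trans_lt ht.2), smul_eq_mul]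
    ring
  have hintegral : ∀ t ∈ Ico 0 T, ∫ s in (0 : ℝ)..t, (x s - b s) / (v s - s) =
      IsBridgeRate.weightedAverage (fun s ↦ v s - s) (fun s ↦ x s - w s) t := fun t ht ↦ by
    rw [intervalIntegral.integral_congr (hdrift t ht),
      H.integral_inv_smul_sub_weightedAverage (hy.mono Ico_subset_Icc_self) ht]
  refine ⟨fun t ht ↦ ?_, fun t ht ↦ ?_, ?_⟩
  · have hb' := (H.continuousOn_bridge hw hx).congr hb
    refine (H.intervalIntegrable_inv t ht).continuousOn_mul ((hx.sub hb').mono ?_)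
    rw [uIcc_of_le ht.1]
    exact Icc_subset_Icc_right ht.2.le
  · rw [hintegral t ht, hb ⟨ht.1, ht.2.le⟩, bridge_of_lt ht.2]
  · have hlim := (H.tendsto_weightedAverage hy).const_add (w T)
    rw [add_sub_cancel] at hlim
    rw [hb ⟨H.pos_T.le, le_rfl⟩, bridge_self]
    refine hlim.congr' ?_
    filter_upwards [Ioo_mem_nhdsLT H.pos_T] with t ht
    rw [hintegral t ⟨ht.1.le, ht.2⟩]

lemma iff_eqOn_bridge (H : IsBridgeRate T (fun s ↦ v s - s)) (hw : ContinuousOn w (Icc 0 T))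
    (hx : ContinuousOn x (Icc 0 T)) :
    IsSolutionPath T v x w b ↔ EqOn b (bridge T (fun s ↦ v s - s) w x) (Icc 0 T) :=
  ⟨eqOn_bridge H hw hx, of_eqOn_bridge H hw hx⟩

end IsSolutionPath

/-! ### The equation in a Hilbert space -/

section OrthogonalIncrements

open scoped InnerProductSpace

open IsBridgeRate

variable {E : Type*} [NormedAddCommGroup E] [InnerProductSpace ℝ E] {T s t : ℝ} {v : ℝ → ℝ}
  {w x : ℝ → E}

/-- The curve `x` in a Hilbert space has increments on `[0, T]` that are orthogonal to its past, and
`‖x t‖ ^ 2 = v t`. In `L²`, these are the centred processes with uncorrelated increments,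
uncorrelated with the initial value, and with variance `v`. -/
def HasOrthogonalIncrements (T : ℝ) (v : ℝ → ℝ) (x : ℝ → E) : Prop :=
  ∀ s ∈ Icc 0 T, ∀ t ∈ Icc 0 T, s ≤ t → ⟪x s, x t⟫_ℝ = v s

lemma HasOrthogonalIncrements.norm_sub_sq (hx : HasOrthogonalIncrements T v x) (hs : s ∈ Icc 0 T)
    (ht : t ∈ Icc 0 T) : ‖x s - x t‖ ^ 2 = |v s - v t| := by
  wlog hst : s ≤ t generalizing s t
  · rw [norm_sub_rev, abs_sub_comm, this ht hs (not_le.1 hst).le]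
  have hsq : ‖x s - x t‖ ^ 2 = v t - v s := by
    rw [norm_sub_sq_real, hx s hs t ht hst, ← real_inner_self_eq_norm_sq,
      ← real_inner_self_eq_norm_sq, hx s hs s hs le_rfl, hx t ht t ht le_rfl]
    ring
  rw [abs_sub_comm, ← hsq, abs_of_nonneg (sq_nonneg _)]

lemma HasOrthogonalIncrements.continuousOn (hx : HasOrthogonalIncrements T v x)
    (hv : ContinuousOn v (Icc 0 T)) : ContinuousOn x (Icc 0 T) := by
  intro t ht
  refine tendsto_iff_norm_sub_tendsto_zero.2 ?_
  have hlim : Tendsto (fun s ↦ √|v s - v t|) (𝓝[Icc 0 T] t) (𝓝 0) := by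
    simpa using ((hv t ht).tendsto.sub_const (v t)).abs.sqrt
  refine hlim.congr' ?_
  filter_upwards [self_mem_nhdsWithin] with s hs
  rw [← hx.norm_sub_sq hs ht, Real.sqrt_sq (norm_nonneg _)]

lemma IsBridgeRate.inner_weightedAverage [CompleteSpace E] {h : ℝ → ℝ} {y : ℝ → E}
    (H : IsBridgeRate T h) (hy : ContinuousOn y (Ico 0 T)) (z : E) (ht : t ∈ Ico 0 T) :
    ⟪z, weightedAverage h y t⟫_ℝ = weightedAverage h (fun s ↦ ⟪z, y s⟫_ℝ) t :=
  H.map_weightedAverage hy (innerSL ℝ z) ht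

/-- The Hilbert space version of the data `w = W²`, `x = V`, `v = Var V` of the equation. -/
structure IsBridgePair (T : ℝ) (v : ℝ → ℝ) (w x : ℝ → E) : Prop where
  rate : IsBridgeRate T (fun t ↦ v t - t)
  cont : ContinuousOn v (Icc 0 T)
  eq_end : v T = T
  left : HasOrthogonalIncrements T id w
  right : HasOrthogonalIncrements T v x
  orthogonal : ∀ s ∈ Icc 0 T, ∀ t ∈ Icc 0 T, ⟪w s, x t⟫_ℝ = 0

namespace IsBridgePair

/-- The integral term of the equation, evaluated at its solution. -/
noncomputable abbrev drift (v : ℝ → ℝ) (w x : ℝ → E) (t : ℝ) : E :=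
  weightedAverage (fun s ↦ v s - s) (fun s ↦ x s - w s) t

/-- Half the squared norm of the drift. -/
noncomputable abbrev halfDriftVar (v : ℝ → ℝ) (t : ℝ) : ℝ := weightedAverage (fun s ↦ v s - s) id t

lemma continuousOn_sub (hp : IsBridgePair T v w x) : ContinuousOn (fun t ↦ x t - w t) (Ico 0 T) :=
  ((hp.right.continuousOn hp.cont).sub (hp.left.continuousOn continuousOn_id)).mono
    Ico_subset_Icc_self

variable [CompleteSpace E]

lemma inner_right_drift (hp : IsBridgePair T v w x) (hs : s ∈ Ico 0 T) (hst : s ≤ t)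
    (ht : t ≤ T) : ⟪x t, drift v w x s⟫_ℝ = s := by
  have ht' : t ∈ Icc 0 T := ⟨hs.1.trans hst, ht⟩
  have hv : ContinuousOn (fun r ↦ v r - r) (Ico 0 T) :=
    (hp.cont.sub continuousOn_id).mono Ico_subset_Icc_self
  rw [hp.rate.inner_weightedAverage hp.continuousOn_sub _ hs,
    weightedAverage_congr hs.1 (y' := fun r ↦ v r - r + r), hp.rate.weightedAverage_add_id hv hs]
  intro r hr
  have hr' : r ∈ Icc 0 T := ⟨hr.1, hr.2.trans hs.2.le⟩
  simp only [inner_sub_right, real_inner_comm (x r), real_inner_comm (w r)]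
  rw [hp.right r hr' t ht' (hr.2.trans hst), hp.orthogonal r hr' t ht']
  ring

lemma inner_left_drift (hp : IsBridgePair T v w x) (hs : s ∈ Ico 0 T) (hst : s ≤ t)
    (ht : t ≤ T) : ⟪w t, drift v w x s⟫_ℝ = -halfDriftVar v s := by
  have ht' : t ∈ Icc 0 T := ⟨hs.1.trans hst, ht⟩
  rw [← neg_eq_iff_eq_neg, ← inner_neg_left, hp.rate.inner_weightedAverage hp.continuousOn_sub _ hs]
  refine weightedAverage_congr hs.1 fun r hr ↦ ?_
  have hr' : r ∈ Icc 0 T := ⟨hr.1, hr.2.trans hs.2.le⟩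
  rw [inner_neg_left, inner_sub_right, hp.orthogonal t ht' r hr', real_inner_comm,
    hp.left r hr' t ht' (hr.2.trans hst)]
  ring

lemma inner_drift_self (hp : IsBridgePair T v w x) (ht : t ∈ Ico 0 T) :
    ⟪drift v w x t, drift v w x t⟫_ℝ = 2 * halfDriftVar v t := by
  have hA := hp.rate.continuousOn_weightedAverage hp.continuousOn_sub
  -- The difference `u` of the two sides satisfies `u' = -u / (h / 2)` and `u 0 = 0`.
  have hu := hp.rate.div_two.eqOn_weightedAverage (y := fun _ ↦ (0 : ℝ))
    (u := fun t ↦ ⟪drift v w x t, drift v w x t⟫_ℝ - 2 * halfDriftVar v t) continuousOn_const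
    (by simp only [weightedAverage_zero, inner_zero_left, mul_zero, sub_zero])
    ((hA.inner hA).sub ((hp.rate.continuousOn_weightedAverage continuousOn_id).const_mul 2))
    fun t ht ↦ ?_
  · rw [← sub_eq_zero]
    exact (hu ht).trans (by simp [weightedAverage])
  have hderiv := hp.rate.hasDerivAt_weightedAverage hp.continuousOn_sub ht
  refine ((hderiv.inner ℝ hderiv).sub
    ((hp.rate.hasDerivAt_weightedAverage continuousOn_id ht).const_mul 2)).congr_deriv ?_
  have hs : t ∈ Ico 0 T := ⟨ht.1.le, ht.2⟩
  have hinner : ⟪x t - w t, drift v w x t⟫_ℝ = t + halfDriftVar v t := by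
    rw [inner_sub_left, hp.inner_right_drift hs le_rfl ht.2.le,
      hp.inner_left_drift hs le_rfl ht.2.le, sub_neg_eq_add]
  have hpos := (hp.rate.pos t ht).ne'
  rw [real_inner_comm, real_inner_smul_left, inner_sub_left, hinner]
  simp only [smul_eq_mul, id]
  field_simp
  ring

lemma inner_solution_sub (hp : IsBridgePair T v w x) (hs : s ∈ Ico 0 T) (hst : s ≤ t)
    (ht : t ≤ T) : ⟪w s + drift v w x s, x t - w t⟫_ℝ = halfDriftVar v s := by
  have hs' : s ∈ Icc 0 T := ⟨hs.1, hs.2.le⟩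
  have ht' : t ∈ Icc 0 T := ⟨hs.1.trans hst, ht⟩
  rw [inner_add_left, inner_sub_right, inner_sub_right, hp.orthogonal s hs' t ht',
    hp.left s hs' t ht' hst, real_inner_comm (x t), hp.inner_right_drift hs hst ht,
    real_inner_comm (w t), hp.inner_left_drift hs hst ht, id]
  ring

lemma inner_solution_drift (hp : IsBridgePair T v w x) (hs : s ∈ Ico 0 T) (hst : s ≤ t)
    (ht : t < T) : ⟪w s + drift v w x s, drift v w x t⟫_ℝ = halfDriftVar v s := by
  have ht' : t ∈ Ico 0 T := ⟨hs.1.trans hst, ht⟩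
  rw [hp.rate.inner_weightedAverage hp.continuousOn_sub _ ht']
  refine hp.rate.weightedAverage_eq_of_forall_eq (continuousOn_const.inner hp.continuousOn_sub)
    hs.1 hst ht ?_ fun r hr ↦ hp.inner_solution_sub hs hr.1 (hr.2.trans ht.le)
  rw [← hp.rate.inner_weightedAverage hp.continuousOn_sub _ hs, inner_add_left,
    hp.inner_left_drift hs le_rfl hs.2.le, hp.inner_drift_self hs]
  ring

theorem hasOrthogonalIncrements_bridge (hp : IsBridgePair T v w x) :
    HasOrthogonalIncrements T id (bridge T (fun t ↦ v t - t) w x) := by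
  intro s hs t ht hst
  rcases hs.2.lt_or_eq with hsT | rfl
  · have hs' : s ∈ Ico 0 T := ⟨hs.1, hsT⟩
    rw [bridge_of_lt hsT]
    rcases ht.2.lt_or_eq with htT | rfl
    · rw [bridge_of_lt htT, inner_add_right, hp.inner_solution_drift hs' hst htT, inner_add_left,
        hp.left s hs t ht hst, real_inner_comm, hp.inner_left_drift hs' hst ht.2, id]
      ring
    · rw [bridge_self, inner_add_left, hp.orthogonal s hs t ht, real_inner_comm,
        hp.inner_right_drift hs' hst le_rfl, zero_add, id]
  · obtain rfl : t = s := le_antisymm ht.2 hst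
    rw [bridge_self, hp.right t ht t ht le_rfl, hp.eq_end, id]

end IsBridgePair

end OrthogonalIncrements

/-! ### Integrals in `Lᵖ` -/

section IntegralLp

variable {X Ω E : Type*} [MeasurableSpace X] [MeasurableSpace Ω] {P : Measure Ω} {μ : Measure X}
  [NormedAddCommGroup E] [NormedSpace ℝ E]

lemma coeFn_sum_smul {ι : Type*} {p : ENNReal} (I : Finset ι) (c : ι → ℝ) (y : ι → Lp E p P) :
    ⇑(∑ i ∈ I, c i • y i) =ᵐ[P] fun ω ↦ ∑ i ∈ I, c i • y i ω := by
  classical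
  induction I using Finset.induction_on with
  | empty => simpa using! Lp.coeFn_zero E p P
  | insert i I hi ih =>
    rw [Finset.sum_insert hi]
    filter_upwards [ih, Lp.coeFn_add (c i • y i) (∑ j ∈ I, c j • y j), Lp.coeFn_smul (c i) (y i)]
      with ω hI hadd hsmul
    rw [hadd, Pi.add_apply, hI, hsmul, Finset.sum_insert hi, Pi.smul_apply]

lemma integral_smul_comp_simpleFunc [CompleteSpace E] {S : Type*} {g : X → ℝ} (hg : Integrable g μ)
    (φ : SimpleFunc X S) (y : S → E) :
    ∫ s, g s • y (φ s) ∂μ = ∑ a ∈ φ.range, (∫ s in φ ⁻¹' {a}, g s ∂μ) • y a := by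
  have hsum : ∀ s, g s • y (φ s) =
      ∑ a ∈ φ.range, (φ ⁻¹' {a}).indicator (fun s ↦ g s • y a) s := fun s ↦ by
    rw [Finset.sum_eq_single_of_mem _ (φ.mem_range_self s), indicator_of_mem (by simp)]
    exact fun a _ ha ↦ indicator_of_notMem (by simpa using ha.symm) _
  simp only [hsum]
  rw [integral_finsetSum _ fun a _ ↦ (hg.smul_const _).indicator (φ.measurableSet_fiber a)]
  simp only [integral_indicator (φ.measurableSet_fiber _), integral_smul_const]

variable [MetricSpace X] [SecondCountableTopology X] [OpensMeasurableSpace X]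
  {K : Set X} {g : X → ℝ}

lemma tendsto_integral_smul_comp_approxOn {y : X → E} (hK : IsCompact K)
    (hg : IntegrableOn g K μ) (hy : ContinuousOn y K) {a : X} (ha : a ∈ K) :
    Tendsto (fun n ↦ ∫ s in K, g s • y (SimpleFunc.approxOn id measurable_id K a ha n s) ∂μ) atTop
      (𝓝 (∫ s in K, g s • y s ∂μ)) := by
  obtain ⟨C, hC⟩ := hK.exists_bound_of_continuousOn hy
  have hmem := SimpleFunc.approxOn_mem measurable_id (s := K) ha
  refine tendsto_integral_of_dominated_convergence (fun s ↦ ‖g s‖ * C) (fun n ↦ ?_)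
    (hg.norm.mul_const C) (fun n ↦ ae_of_all _ fun s ↦ ?_) ?_
  · exact hg.aestronglyMeasurable.smul
      ((SimpleFunc.approxOn id measurable_id K a ha n).map y).aestronglyMeasurable
  · rw [norm_smul]
    exact mul_le_mul_of_nonneg_left (hC _ (hmem n s)) (norm_nonneg _)
  · filter_upwards [ae_restrict_mem hK.isClosed.measurableSet] with s hs
    refine ((hy s hs).tendsto.comp (tendsto_nhdsWithin_iff.2 ⟨?_, ?_⟩)).const_smul (g s)
    · exact SimpleFunc.tendsto_approxOn measurable_id ha (subset_closure hs)
    · exact Eventually.of_forall fun n ↦ hmem n s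

/-- Both sides are limits along the same simple approximations of the curve, which involve only
finitely many of the variables `Y s` at a time. -/
lemma coeFn_setIntegral_smul [CompleteSpace E] {p : ENNReal} [Fact (1 ≤ p)] {y : X → Lp E p P}
    {Y : X → Ω → E} (hK : IsCompact K) (hg : IntegrableOn g K μ) (hy : ContinuousOn y K)
    (hyY : ∀ s ∈ K, y s =ᵐ[P] Y s) (hY : ∀ᵐ ω ∂P, ContinuousOn (fun s ↦ Y s ω) K) :
    ⇑(∫ s in K, g s • y s ∂μ) =ᵐ[P] fun ω ↦ ∫ s in K, g s • Y s ω ∂μ := by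
  rcases K.eq_empty_or_nonempty with rfl | ⟨a, ha⟩
  · simpa using! Lp.coeFn_zero E p P
  let φ := SimpleFunc.approxOn id measurable_id K a ha
  have happrox : ∀ n, ⇑(∫ s in K, g s • y (φ n s) ∂μ) =ᵐ[P]
      fun ω ↦ ∫ s in K, g s • Y (φ n s) ω ∂μ := fun n ↦ by
    have hvalues : ∀ᵐ ω ∂P, ∀ b ∈ (φ n).range, y b ω = Y b ω := by
      refine (Finset.eventually_all _).2 fun b hb ↦ hyY b ?_
      obtain ⟨s, rfl⟩ := SimpleFunc.mem_range.1 hb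
      exact SimpleFunc.approxOn_mem measurable_id ha n s
    rw [integral_smul_comp_simpleFunc hg]
    filter_upwards [coeFn_sum_smul (φ n).range (fun b ↦ ∫ s in φ n ⁻¹' {b}, g s ∂μ.restrict K) y,
      hvalues] with ω hsum hω
    rw [hsum, integral_smul_comp_simpleFunc hg (φ n) fun s ↦ Y s ω]
    exact Finset.sum_congr rfl fun b hb ↦ by rw [hω b hb]
  obtain ⟨k, hk, hlim⟩ := (tendstoInMeasure_of_tendsto_Lp
    (tendsto_integral_smul_comp_approxOn hK hg hy ha)).exists_seq_tendsto_ae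
  filter_upwards [hlim, hY, ae_all_iff.2 happrox] with ω hω hcont heq
  simp only [φ] at heq
  simp only [heq] at hω
  exact tendsto_nhds_unique hω
    ((tendsto_integral_smul_comp_approxOn hK hg hcont ha).comp hk.tendsto_atTop)

end IntegralLp

namespace IsBridgeRate

variable {T t : ℝ} {h : ℝ → ℝ}

lemma weightedAverage_mem {E : Type*} [NormedAddCommGroup E] [InnerProductSpace ℝ E]
    [CompleteSpace E] {S : Submodule ℝ E} {y : ℝ → E} (H : IsBridgeRate T h)
    (hS : IsClosed (S : Set E)) (hy : ContinuousOn y (Ico 0 T)) (hyS : ∀ s ∈ Icc 0 t, y s ∈ S)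
    (ht : t ∈ Ico 0 T) : weightedAverage h y t ∈ S := by
  have := hS.completeSpace_coe
  rw [← S.orthogonal_orthogonal, Submodule.mem_orthogonal]
  intro z hz
  rw [H.inner_weightedAverage hy z ht, weightedAverage_congr (y' := 0) ht.1
    fun s hs ↦ Submodule.inner_left_of_mem_orthogonal (hyS s hs) hz]
  simp [weightedAverage]

section

variable {Ω E : Type*} [MeasurableSpace Ω] {P : Measure Ω} [NormedAddCommGroup E] [NormedSpace ℝ E]
  [CompleteSpace E] {p : ENNReal} [Fact (1 ≤ p)]

lemma coeFn_weightedAverage {y : ℝ → Lp E p P} {Y : ℝ → Ω → E} (H : IsBridgeRate T h)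
    (hy : ContinuousOn y (Ico 0 T)) (hyY : ∀ s ∈ Icc 0 t, y s =ᵐ[P] Y s)
    (hY : ∀ᵐ ω ∂P, ContinuousOn (fun s ↦ Y s ω) (Icc 0 t)) (ht : t ∈ Ico 0 T) :
    ⇑(weightedAverage h y t) =ᵐ[P] fun ω ↦ weightedAverage h (fun s ↦ Y s ω) t := by
  simp only [weightedAverage, intervalIntegral.integral_of_le ht.1, ← integral_Icc_eq_integral_Ioc]
  have hg := (intervalIntegrable_iff_integrableOn_Icc_of_le ht.1).1 (H.intervalIntegrable_weight ht)
  filter_upwards [Lp.coeFn_smul (factor h t)⁻¹ (∫ s in Icc 0 t, weight h s • y s),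
    coeFn_setIntegral_smul isCompact_Icc hg (hy.mono (Icc_subset_Ico_right ht.2)) hyY hY]
    with ω hsmul hint
  rw [hsmul, Pi.smul_apply, hint]

lemma coeFn_bridge {w x : ℝ → Lp E p P} {W X : ℝ → Ω → E} (H : IsBridgeRate T h)
    (hw : ContinuousOn w (Icc 0 T)) (hx : ContinuousOn x (Icc 0 T))
    (hwW : ∀ s ∈ Icc 0 T, w s =ᵐ[P] W s) (hxX : ∀ s ∈ Icc 0 T, x s =ᵐ[P] X s)
    (hW : ∀ᵐ ω ∂P, ContinuousOn (fun s ↦ W s ω) (Icc 0 T))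
    (hX : ∀ᵐ ω ∂P, ContinuousOn (fun s ↦ X s ω) (Icc 0 T)) (ht : t ∈ Icc 0 T) :
    ⇑(bridge T h w x t) =ᵐ[P] fun ω ↦ bridge T h (fun s ↦ W s ω) (fun s ↦ X s ω) t := by
  rcases ht.2.lt_or_eq with htT | rfl
  · have hsub : Icc 0 t ⊆ Icc 0 T := Icc_subset_Icc_right htT.le
    have hY : ∀ s ∈ Icc 0 t, ⇑(x s - w s) =ᵐ[P] fun ω ↦ X s ω - W s ω := fun s hs ↦
      (Lp.coeFn_sub _ _).trans ((hxX s (hsub hs)).sub (hwW s (hsub hs)))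
    have havg := H.coeFn_weightedAverage ((hx.sub hw).mono Ico_subset_Icc_self) hY
      (by filter_upwards [hW, hX] with ω hWω hXω using (hXω.sub hWω).mono hsub) ⟨ht.1, htT⟩
    simp only [bridge_of_lt htT]
    exact (Lp.coeFn_add _ _).trans ((hwW t ht).add havg)
  · simpa only [bridge_self] using hxX t ht

end

lemma bridge_mem {E : Type*} [NormedAddCommGroup E] [InnerProductSpace ℝ E]
    [CompleteSpace E] {S : Submodule ℝ E} {w x : ℝ → E} (H : IsBridgeRate T h)
    (hS : IsClosed (S : Set E)) (hw : ContinuousOn w (Icc 0 T)) (hx : ContinuousOn x (Icc 0 T))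
    (hwS : ∀ s ∈ Icc 0 T, w s ∈ S) (hxS : ∀ s ∈ Icc 0 T, x s ∈ S) (ht : t ∈ Icc 0 T) :
    bridge T h w x t ∈ S := by
  rcases ht.2.lt_or_eq with htT | rfl
  · have hsub : Icc 0 t ⊆ Icc 0 T := Icc_subset_Icc_right htT.le
    rw [bridge_of_lt htT]
    exact S.add_mem (hwS t ht) (H.weightedAverage_mem hS ((hx.sub hw).mono Ico_subset_Icc_self)
      (fun s hs ↦ S.sub_mem (hxS s (hsub hs)) (hwS s (hsub hs))) ⟨ht.1, htT⟩)
  · rw [bridge_self]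
    exact hxS t ht

end IsBridgeRate

/-! ### Gaussian spaces -/

section GaussianSpace

variable {Ω : Type*} [MeasurableSpace Ω] {P : Measure Ω} {X Y : Ω → ℝ}

/-- The class of the random variable `X` in `L²(P)`, and the junk value `0` if `X` is not square
integrable. -/
noncomputable def toL2 (P : Measure Ω) (X : Ω → ℝ) : Lp ℝ 2 P :=
  open scoped Classical in if h : MemLp X 2 P then h.toLp X else 0

lemma coeFn_toL2 (hX : MemLp X 2 P) : toL2 P X =ᵐ[P] X := by
  rw [toL2, dif_pos hX]
  exact hX.coeFn_toLp

lemma inner_toL2 (hX : MemLp X 2 P) (hY : MemLp Y 2 P) :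
    inner ℝ (toL2 P X) (toL2 P Y) = ∫ ω, X ω * Y ω ∂P := by
  rw [L2.inner_def]
  refine integral_congr_ae ?_
  filter_upwards [coeFn_toL2 hX, coeFn_toL2 hY] with ω hXω hYω
  rw [hXω, hYω, RCLike.inner_apply, conj_trivial, mul_comm]

lemma tendsto_toL2 {ι : Type*} {l : Filter ι} {Z : ι → Ω → ℝ} (hX : MemLp X 2 P)
    (hZ : ∀ i, MemLp (Z i) 2 P) (h : Tendsto (fun i ↦ eLpNorm (Z i - X) 2 P) l (𝓝 0)) :
    Tendsto (fun i ↦ toL2 P (Z i)) l (𝓝 (toL2 P X)) := by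
  rw [Lp.tendsto_Lp_iff_tendsto_eLpNorm']
  exact h.congr fun i ↦ eLpNorm_congr_ae ((coeFn_toL2 (hZ i)).symm.sub (coeFn_toL2 hX).symm)

lemma norm_sq_eq_variance {Z : Lp ℝ 2 P} (hZ : ∫ ω, Z ω ∂P = 0) : ‖Z‖ ^ 2 = Var[Z; P] := by
  rw [variance_of_integral_eq_zero (Lp.aestronglyMeasurable Z).aemeasurable hZ,
    ← real_inner_self_eq_norm_sq, L2.inner_def]
  simp only [RCLike.inner_apply, conj_trivial, pow_two]

/-- A linear subspace of `L²(P)` that consists of centred Gaussian random variables. -/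
def IsGaussianSpace (S : Submodule ℝ (Lp ℝ 2 P)) : Prop :=
  ∀ Z ∈ S, HasLaw Z (gaussianReal 0 (‖Z‖₊ ^ 2)) P

/-- The centred Gaussian variables are closed in `L²`, since their characteristic functions depend
continuously on the norm. -/
lemma IsGaussianSpace.topologicalClosure {S : Submodule ℝ (Lp ℝ 2 P)} (hS : IsGaussianSpace S) :
    IsGaussianSpace S.topologicalClosure := by
  intro Z hZ
  have := (hS 0 S.zero_mem).hasGaussianLaw.isProbabilityMeasure
  obtain ⟨u, hu, hlim⟩ := mem_closure_iff_seq_limit.1 (SetLike.mem_coe.2 hZ)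
  have hu_meas : ∀ n, AEMeasurable (u n) P := fun n ↦ (Lp.aestronglyMeasurable (u n)).aemeasurable
  have hZ_meas : AEMeasurable Z P := (Lp.aestronglyMeasurable Z).aemeasurable
  have hdist := (tendstoInMeasure_of_tendsto_Lp hlim).tendstoInDistribution hu_meas
  refine ⟨hZ_meas, ?_⟩
  have := Measure.isProbabilityMeasure_map (μ := P) hZ_meas
  refine Measure.ext_of_charFun (funext fun t ↦ ?_)
  refine tendsto_nhds_unique (ProbabilityMeasure.tendsto_iff_tendsto_charFun.1 hdist.tendsto t) ?_
  have hnorm : Tendsto (fun n ↦ ((‖u n‖ : ℝ) : ℂ)) atTop (𝓝 (‖Z‖ : ℝ)) :=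
    (Complex.continuous_ofReal.tendsto _).comp hlim.norm
  simp only [ProbabilityMeasure.coe_mk, (hS _ (hu _)).map_eq, charFun_gaussianReal]
  refine (Complex.continuous_exp.tendsto _).comp ?_
  simpa using (((hnorm.pow 2).mul_const ((t : ℂ) ^ 2)).div_const 2).const_sub 0

lemma isGaussianSpace_span {ι : Type*} {Y : ι → Lp ℝ 2 P}
    (hY : IsGaussianProcess (fun i ω ↦ Y i ω) P) (h0 : ∀ i, ∫ ω, Y i ω ∂P = 0) :
    IsGaussianSpace (Submodule.span ℝ (range Y)) := by
  intro Z hZ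
  have := hY.isProbabilityMeasure
  obtain ⟨c, rfl⟩ := Finsupp.mem_span_range_iff_exists_finsupp.1 hZ
  rw [Finsupp.sum]
  have hsum := coeFn_sum_smul c.support c Y
  have hgauss := ((hY.smul c).hasGaussianLaw_fun_sum (I := c.support)).congr hsum.symm
  have hmean : ∫ ω, (∑ i ∈ c.support, c i • Y i : Lp ℝ 2 P) ω ∂P = 0 := by
    rw [integral_congr_ae hsum, integral_finsetSum]
    · simp [integral_const_mul, h0]
    · exact fun i _ ↦ ((Lp.memLp (Y i)).integrable (by norm_num)).smul (c i)
  refine ⟨hgauss.aemeasurable, ?_⟩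
  rw [hgauss.map_eq_gaussianReal, hmean, ← norm_sq_eq_variance hmean]
  congr 1
  ext
  simp

lemma strongDual_pi_eq_sum {ι : Type*} [Fintype ι] [DecidableEq ι] (L : StrongDual ℝ (ι → ℝ)) :
    L = ∑ i, L (Pi.single i 1) • ContinuousLinearMap.proj i := by
  ext x
  conv_lhs => rw [pi_eq_sum_univ' x]
  simp [mul_comm]

lemma isGaussian_pi_ext {ι : Type*} [Finite ι] {μ ν : Measure (ι → ℝ)} [IsGaussian μ]
    [IsGaussian ν] (hmean : ∀ i, ∫ x, x i ∂μ = ∫ x, x i ∂ν)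
    (hcov : ∀ i j, cov[fun x ↦ x i, fun x ↦ x j; μ] = cov[fun x ↦ x i, fun x ↦ x j; ν]) :
    μ = ν := by
  classical
  have := Fintype.ofFinite ι
  refine IsGaussian.ext_covarianceBilinDual (funext fun i ↦ ?_) ?_
  · rw [eval_integral, eval_integral]
    · exact hmean i
    · exact fun i ↦ IsGaussian.integrable_dual ν (ContinuousLinearMap.proj i)
    · exact fun i ↦ IsGaussian.integrable_dual μ (ContinuousLinearMap.proj i)
  · ext L M
    rw [strongDual_pi_eq_sum L, strongDual_pi_eq_sum M]
    simp only [map_sum, map_smul, sum_apply, smul_apply,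
      covarianceBilinDual_eq_covariance IsGaussian.memLp_two_id]
    exact Finset.sum_congr rfl fun i _ ↦ congrArg _ (Finset.sum_congr rfl fun j _ ↦
      congrArg _ (hcov j i))

namespace IsGaussianSpace

variable {S : Submodule ℝ (Lp ℝ 2 P)}

lemma integral_eq_zero (hS : IsGaussianSpace S) {Z : Lp ℝ 2 P} (hZ : Z ∈ S) :
    ∫ ω, Z ω ∂P = 0 := by
  rw [(hS Z hZ).integral_eq, integral_id_gaussianReal]

lemma hasGaussianLaw_pi (hS : IsGaussianSpace S) {ι : Type*} [Finite ι] {Y : ι → Lp ℝ 2 P}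
    (hY : ∀ i, Y i ∈ S) : HasGaussianLaw (fun ω i ↦ Y i ω) P := by
  classical
  have := Fintype.ofFinite ι
  have hmeas : AEMeasurable (fun ω i ↦ Y i ω) P :=
    aemeasurable_pi_lambda _ fun i ↦ (Lp.aestronglyMeasurable (Y i)).aemeasurable
  refine ⟨isGaussian_of_isGaussian_map fun L ↦ ?_⟩
  rw [AEMeasurable.map_map_of_aemeasurable (by fun_prop) hmeas]
  have hZ : ∑ i, L (Pi.single i 1) • Y i ∈ S :=
    Submodule.sum_mem _ fun i _ ↦ S.smul_mem _ (hY i)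
  refine ((hS _ hZ).hasGaussianLaw.congr ?_).isGaussian_map
  filter_upwards [coeFn_sum_smul Finset.univ (fun i ↦ L (Pi.single i 1)) Y] with ω hω
  rw [hω, Function.comp_apply]
  conv_rhs => rw [strongDual_pi_eq_sum L]
  simp

lemma covariance_eq_inner (hS : IsGaussianSpace S) {Y Z : Lp ℝ 2 P} (hY : Y ∈ S) :
    cov[Y, Z; P] = inner ℝ Y Z := by
  have := (hS Y hY).hasGaussianLaw.isProbabilityMeasure
  rw [covariance_eq_sub (Lp.memLp Y) (Lp.memLp Z), hS.integral_eq_zero hY, zero_mul, sub_zero,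
    L2.inner_def]
  simp only [Pi.mul_apply, RCLike.inner_apply, conj_trivial, mul_comm]

lemma hasLaw_projectiveFamily (hS : IsGaussianSpace S) (I : Finset NNReal) {Y : I → Lp ℝ 2 P}
    (hY : ∀ t, Y t ∈ S) (hin : ∀ s t : I, s ≤ t → inner ℝ (Y s) (Y t) = (s.1 : ℝ)) :
    HasLaw (fun ω t ↦ Y t ω) (BrownianReal.projectiveFamily I) P := by
  have hgauss := hS.hasGaussianLaw_pi hY
  have hinner : ∀ s t, inner ℝ (Y s) (Y t) = (min s.1 t.1 : ℝ) := by
    intro s t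
    wlog hst : s ≤ t generalizing s t
    · rw [real_inner_comm, this t s (not_le.1 hst).le, min_comm]
    rw [hin s t hst, min_eq_left (NNReal.coe_le_coe.2 hst)]
  have := hgauss.isGaussian_map
  refine ⟨hgauss.aemeasurable, isGaussian_pi_ext (fun t ↦ ?_) fun s t ↦ ?_⟩
  · rw [BrownianReal.integral_eval_projectiveFamily,
      integral_map hgauss.aemeasurable (measurable_pi_apply t).aestronglyMeasurable]
    exact hS.integral_eq_zero (hY t)
  · rw [BrownianReal.covariance_eval_projectiveFamily,
      covariance_map (measurable_pi_apply s).aestronglyMeasurable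
        (measurable_pi_apply t).aestronglyMeasurable hgauss.aemeasurable]
    exact (hS.covariance_eq_inner (hY s)).trans (by rw [hinner, NNReal.coe_min])

end IsGaussianSpace

end GaussianSpace

section GaussianProcess

variable {Ω : Type*} [MeasurableSpace Ω] {P : Measure Ω}

lemma isGaussianProcess_sumElim {ι κ : Type*} {X : ι → Ω → ℝ} {Y : κ → Ω → ℝ}
    (hX : IsGaussianProcess X P) (hY : IsGaussianProcess Y P)
    (h : IndepFun (fun ω i ↦ X i ω) (fun ω j ↦ Y j ω) P) :
    IsGaussianProcess (Sum.elim X Y) P where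
  hasGaussianLaw I := by
    have hind : IndepFun (fun ω ↦ I.toLeft.restrict (X · ω))
        (fun ω ↦ I.toRight.restrict (Y · ω)) P :=
      h.comp (Finset.measurable_restrict I.toLeft) (Finset.measurable_restrict I.toRight)
    let L : ((I.toLeft → ℝ) × (I.toRight → ℝ)) →L[ℝ] (I → ℝ) := ContinuousLinearMap.pi fun i ↦
      match i with
      | ⟨.inl i, hi⟩ => (ContinuousLinearMap.proj ⟨i, by simpa using hi⟩).comp
          (ContinuousLinearMap.fst ℝ _ _)
      | ⟨.inr j, hj⟩ => (ContinuousLinearMap.proj ⟨j, by simpa using hj⟩).comp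
          (ContinuousLinearMap.snd ℝ _ _)
    have hL : (fun ω ↦ I.restrict (Sum.elim X Y · ω)) =
        L ∘ fun ω ↦ (I.toLeft.restrict (X · ω), I.toRight.restrict (Y · ω)) := by
      funext ω ⟨i, _⟩
      cases i <;> rfl
    rw [hL]
    exact (hind.hasGaussianLaw (hX.hasGaussianLaw _) (hY.hasGaussianLaw _)).map L

lemma isGaussianProcess_const {ι : Type*} {X : Ω → ℝ} (hX : HasGaussianLaw X P) :
    IsGaussianProcess (fun _ : ι ↦ X) P where
  hasGaussianLaw I := hX.map (ContinuousLinearMap.pi fun _ : I ↦ ContinuousLinearMap.id ℝ ℝ)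

namespace IsBrownianOn

variable {T s t : ℝ} {W : ℝ → Ω → ℝ}

lemma isGaussianProcess (hW : IsBrownianOn P T W) :
    IsGaussianProcess (fun (t : Icc 0 T) ω ↦ W t ω) P where
  hasGaussianLaw I := by
    classical
    let J : Finset NNReal := I.image fun t : Icc 0 T ↦ Real.toNNReal t
    have hJ : ∀ t ∈ J, (t : ℝ) ≤ T := by
      simp only [J, Finset.forall_mem_image]
      exact fun t _ ↦ (Real.coe_toNNReal _ t.2.1).trans_le t.2.2
    let L : (J → ℝ) →L[ℝ] (I → ℝ) := ContinuousLinearMap.pi fun i ↦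
      ContinuousLinearMap.proj ⟨Real.toNNReal i.1, Finset.mem_image_of_mem _ i.2⟩
    have hL : (fun ω ↦ I.restrict fun t ↦ W t ω) =
        L ∘ fun ω (t : J) ↦ W ((t : NNReal) : ℝ) ω := by
      funext ω i
      simp [L, Real.coe_toNNReal _ i.1.2.1]
    rw [hL]
    exact (hW.hasLaw J hJ).hasGaussianLaw.map L

lemma memLp_two (hW : IsBrownianOn P T W) (ht : t ∈ Icc 0 T) : MemLp (W t) 2 P :=
  (hW.isGaussianProcess.hasGaussianLaw_eval ⟨t, ht⟩).memLp_two

lemma integral_eval (hW : IsBrownianOn P T W) (ht : t ∈ Icc 0 T) : ∫ ω, W t ω ∂P = 0 := by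
  lift t to NNReal using ht.1
  have hlaw := (BrownianReal.measurePreserving_eval_projectiveFamily ⟨t, by simp⟩).hasLaw.comp
    (hW.hasLaw {t} (by simpa using ht.2))
  exact hlaw.integral_eq.trans integral_id_gaussianReal

lemma covariance_eval (hW : IsBrownianOn P T W) (hs : s ∈ Icc 0 T) (ht : t ∈ Icc 0 T) :
    cov[W s, W t; P] = min s t := by
  lift s to NNReal using hs.1
  lift t to NNReal using ht.1
  have hlaw := hW.hasLaw {s, t} (by simpa using ⟨hs.2, ht.2⟩)
  have hcov := hlaw.covariance_fun_comp (f := Function.eval ⟨s, by simp⟩)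
    (g := Function.eval ⟨t, by simp⟩) (measurable_pi_apply _).aemeasurable
    (measurable_pi_apply _).aemeasurable
  simpa [BrownianReal.covariance_eval_projectiveFamily] using hcov

lemma inner_toL2_eval (hW : IsBrownianOn P T W) (hs : s ∈ Icc 0 T) (ht : t ∈ Icc 0 T) :
    inner ℝ (toL2 P (W s)) (toL2 P (W t)) = min s t := by
  have := hW.isGaussianProcess.isProbabilityMeasure
  rw [inner_toL2 (hW.memLp_two hs) (hW.memLp_two ht), ← hW.covariance_eval hs ht,
    covariance_eq_sub (hW.memLp_two hs) (hW.memLp_two ht), hW.integral_eval hs, zero_mul, sub_zero]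
  rfl

end IsBrownianOn

end GaussianProcess

/-! ### Wiener integrals -/

namespace StepIntegrand

section VectorIntegral

variable {E F : Type*} [NormedAddCommGroup E] [InnerProductSpace ℝ E] [NormedAddCommGroup F]
  [InnerProductSpace ℝ F] {s t T : ℝ} {w : ℝ → E}

/-- The elementary integral `∑ i, c i • (w (t (i + 1)) - w (t i))` of a step function with respect
to a curve in a vector space. -/
noncomputable def vectorIntegral (f : StepIntegrand t) (w : ℝ → E) : E :=
  ∑ i : Fin f.n, f.coeff i • (w (f.node i.succ) - w (f.node i.castSucc))

lemma node_mem_Icc (f : StepIntegrand t) (ht : t ≤ T) (i : Fin (f.n + 1)) : f.node i ∈ Icc 0 T :=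
  ⟨(f.node_mem i).1, (f.node_mem i).2.trans ht⟩

lemma inner_vectorIntegral_eq {e : ℝ → F} (hs : s ≤ T) (ht : t ≤ T)
    (h : ∀ a ∈ Icc 0 T, ∀ b ∈ Icc 0 T, inner ℝ (w a) (w b) = inner ℝ (e a) (e b))
    (f : StepIntegrand s) (g : StepIntegrand t) :
    inner ℝ (f.vectorIntegral w) (g.vectorIntegral w) =
      inner ℝ (f.vectorIntegral e) (g.vectorIntegral e) := by
  simp only [vectorIntegral, sum_inner, inner_sum, inner_smul_left, inner_smul_right,
    inner_sub_left, inner_sub_right, h _ (f.node_mem_Icc hs _) _ (g.node_mem_Icc ht _)]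

lemma vectorIntegral_mem {S : Submodule ℝ E} (ht : t ≤ T) (h : ∀ a ∈ Icc 0 T, w a ∈ S)
    (f : StepIntegrand t) : f.vectorIntegral w ∈ S :=
  Submodule.sum_mem _ fun _ _ ↦ S.smul_mem _
    (S.sub_mem (h _ (f.node_mem_Icc ht _)) (h _ (f.node_mem_Icc ht _)))

end VectorIntegral

section Integral

variable {Ω : Type*} [MeasurableSpace Ω] {P : Measure Ω} {W : ℝ → Ω → ℝ} {t T : ℝ}

lemma memLp_integral (ht : t ≤ T) (hW : ∀ a ∈ Icc 0 T, MemLp (W a) 2 P) (f : StepIntegrand t) :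
    MemLp (f.integral W) 2 P :=
  memLp_finsetSum _ fun _ _ ↦ ((hW _ (f.node_mem_Icc ht _)).sub
    (hW _ (f.node_mem_Icc ht _))).const_mul _

lemma toL2_integral (ht : t ≤ T) (hW : ∀ a ∈ Icc 0 T, MemLp (W a) 2 P) (f : StepIntegrand t) :
    toL2 P (f.integral W) = f.vectorIntegral fun a ↦ toL2 P (W a) := by
  refine Lp.ext ?_
  filter_upwards [coeFn_toL2 (f.memLp_integral ht hW), coeFn_sum_smul Finset.univ f.coeff
      fun i ↦ toL2 P (W (f.node i.succ)) - toL2 P (W (f.node i.castSucc)),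
    ae_all_iff.2 fun i ↦ coeFn_toL2 (hW _ (f.node_mem_Icc ht i)),
    ae_all_iff.2 fun i : Fin f.n ↦ Lp.coeFn_sub (toL2 P (W (f.node i.succ)))
      (toL2 P (W (f.node i.castSucc)))] with ω hint hsum hnode hsub
  simp only [hint, vectorIntegral, hsum, hsub, Pi.sub_apply, hnode, smul_eq_mul, integral]

lemma eval_eq_integral_indicator (f : StepIntegrand t) :
    f.eval = f.integral fun a ↦ (Ioc 0 a).indicator 1 := by
  funext s
  refine Finset.sum_congr rfl fun i _ ↦ ?_
  have hle : f.node i.castSucc ≤ f.node i.succ := f.node_mono (Fin.castSucc_le_succ i)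
  have hpos := (f.node_mem i.castSucc).1
  simp only [indicator_apply, mem_Ioc, Pi.one_apply]
  split_ifs <;> grind

lemma eval_eq_zero (f : StepIntegrand t) {s : ℝ} (hs : s ∉ Ioc 0 t) : f.eval s = 0 :=
  Finset.sum_eq_zero fun _ _ ↦ indicator_of_notMem (fun h ↦ hs
    ⟨(f.node_mem _).1.trans_lt h.1, h.2.trans (f.node_mem _).2⟩) _

end Integral

end StepIntegrand

section Wiener

variable {Ω : Type*} [MeasurableSpace Ω] {P : Measure Ω} {T s t : ℝ} {σ : ℝ → ℝ}

lemma inner_toL2_indicator (hσ : MemLp σ 2 (volume.restrict (Ioc 0 T))) (hs : s ∈ Icc 0 T)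
    (ht : t ∈ Icc 0 T) :
    inner ℝ (toL2 (volume.restrict (Ioc 0 T)) ((Ioc 0 s).indicator σ))
      (toL2 (volume.restrict (Ioc 0 T)) ((Ioc 0 t).indicator σ)) =
      ∫ r in (0 : ℝ)..min s t, σ r ^ 2 := by
  rw [inner_toL2 (hσ.indicator measurableSet_Ioc) (hσ.indicator measurableSet_Ioc),
    intervalIntegral.integral_of_le (le_min hs.1 ht.1)]
  have hprod : (fun r ↦ (Ioc 0 s).indicator σ r * (Ioc 0 t).indicator σ r) =
      (Ioc 0 (min s t)).indicator fun r ↦ σ r ^ 2 := by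
    funext r
    simp only [indicator_apply, mem_Ioc, le_min_iff]
    split_ifs <;> grind
  rw [hprod, integral_indicator measurableSet_Ioc, Measure.restrict_restrict measurableSet_Ioc,
    inter_eq_left.2 (Ioc_subset_Ioc_right ((min_le_left _ _).trans hs.2))]

namespace IsWienerIntegral

variable {W : ℝ → Ω → ℝ} {X Y : Ω → ℝ}

/-- Step functions are their own elementary integrals with respect to `a ↦ 𝟙_(0, a]`, which is why
the same `f` serves in `L²(P)` and in `L²((0, T])`. -/
lemma exists_tendsto_vectorIntegral (hY : IsWienerIntegral P W σ t Y)
    (hσ : MemLp σ 2 (volume.restrict (Ioc 0 T))) (hW : ∀ a ∈ Icc 0 T, MemLp (W a) 2 P)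
    (ht : t ≤ T) :
    ∃ f : ℕ → StepIntegrand t,
      Tendsto (fun k ↦ (f k).vectorIntegral fun a ↦ toL2 P (W a)) atTop (𝓝 (toL2 P Y)) ∧
      Tendsto (fun k ↦ (f k).vectorIntegral fun a ↦
          toL2 (volume.restrict (Ioc 0 T)) ((Ioc 0 a).indicator 1)) atTop
        (𝓝 (toL2 (volume.restrict (Ioc 0 T)) ((Ioc 0 t).indicator σ))) := by
  obtain ⟨hY2, f, hfσ, hfY⟩ := hY
  refine ⟨f, ?_, ?_⟩
  · simp only [← StepIntegrand.toL2_integral ht hW]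
    exact tendsto_toL2 hY2 (fun k ↦ (f k).memLp_integral ht hW) hfY
  · have hind : ∀ a ∈ Icc 0 T,
        MemLp ((Ioc 0 a).indicator (1 : ℝ → ℝ)) 2 (volume.restrict (Ioc 0 T)) := fun a _ ↦
      (memLp_const (1 : ℝ)).indicator measurableSet_Ioc
    simp only [← StepIntegrand.toL2_integral ht hind]
    refine tendsto_toL2 (hσ.indicator measurableSet_Ioc)
      (fun k ↦ (f k).memLp_integral ht hind) (hfσ.congr fun k ↦ ?_)
    have hdiff : (f k).eval - (Ioc 0 t).indicator σ =
        (Ioc 0 t).indicator fun r ↦ (f k).eval r - σ r := by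
      funext r
      by_cases hr : r ∈ Ioc 0 t
      · simp [hr]
      · simp [hr, (f k).eval_eq_zero hr]
    rw [← StepIntegrand.eval_eq_integral_indicator, hdiff,
      eLpNorm_indicator_eq_eLpNorm_restrict measurableSet_Ioc,
      Measure.restrict_restrict measurableSet_Ioc, inter_eq_left.2 (Ioc_subset_Ioc_right ht)]

lemma inner_toL2 (hX : IsWienerIntegral P W σ s X) (hY : IsWienerIntegral P W σ t Y)
    (hW : IsBrownianOn P T W) (hσ : MemLp σ 2 (volume.restrict (Ioc 0 T))) (hs : s ∈ Icc 0 T)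
    (ht : t ∈ Icc 0 T) : inner ℝ (toL2 P X) (toL2 P Y) = ∫ r in (0 : ℝ)..min s t, σ r ^ 2 := by
  obtain ⟨f, hfX, hfσ⟩ := hX.exists_tendsto_vectorIntegral hσ (fun a ↦ hW.memLp_two) hs.2
  obtain ⟨g, hgY, hgσ⟩ := hY.exists_tendsto_vectorIntegral hσ (fun a ↦ hW.memLp_two) ht.2
  rw [← inner_toL2_indicator hσ hs ht]
  refine tendsto_nhds_unique (hfX.inner hgY) ((hfσ.inner hgσ).congr fun k ↦ ?_)
  refine StepIntegrand.inner_vectorIntegral_eq hs.2 ht.2 (fun a ha b hb ↦ ?_) _ _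
  have hind := inner_toL2_indicator (σ := 1) (memLp_const (1 : ℝ)) ha hb
  rw [hW.inner_toL2_eval ha hb, hind]
  simp

lemma toL2_mem {S : Submodule ℝ (Lp ℝ 2 P)} (hY : IsWienerIntegral P W σ t Y)
    (hσ : MemLp σ 2 (volume.restrict (Ioc 0 T))) (hW : ∀ a ∈ Icc 0 T, MemLp (W a) 2 P)
    (ht : t ≤ T) (hS : IsClosed (S : Set (Lp ℝ 2 P))) (hWS : ∀ a ∈ Icc 0 T, toL2 P (W a) ∈ S) :
    toL2 P Y ∈ S := by
  obtain ⟨f, hf, -⟩ := hY.exists_tendsto_vectorIntegral hσ hW ht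
  exact hS.mem_of_tendsto hf
    (Eventually.of_forall fun k ↦ StepIntegrand.vectorIntegral_mem ht hWS (f k))

end IsWienerIntegral

end Wiener

/-! ### The solution as a Gaussian process -/

section GaussianData

variable {Ω : Type*} [MeasurableSpace Ω] {P : Measure Ω} {X Y Z : Ω → ℝ}

lemma inner_toL2_eq_zero_of_indepFun (hX : MemLp X 2 P) (hY : MemLp Y 2 P) (h : IndepFun X Y P)
    (hX0 : ∫ ω, X ω ∂P = 0) : inner ℝ (toL2 P X) (toL2 P Y) = 0 := by
  rw [inner_toL2 hX hY, h.integral_fun_mul_eq_mul_integral hX.1 hY.1, hX0, zero_mul]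

lemma isGaussianProcess_sumElim_const {ι : Type*} {X Y : ι → Ω → ℝ} (hX : IsGaussianProcess X P)
    (hY : IsGaussianProcess Y P) (hXY : IndepFun (fun ω i ↦ X i ω) (fun ω i ↦ Y i ω) P)
    (hZ : HasGaussianLaw Z P) (hXYZ : IndepFun (fun ω i ↦ (X i ω, Y i ω)) Z P) :
    IsGaussianProcess (Sum.elim (Sum.elim X Y) fun _ : Unit ↦ Z) P := by
  refine isGaussianProcess_sumElim (isGaussianProcess_sumElim hX hY hXY)
    (isGaussianProcess_const hZ) ?_
  have hpair : Measurable fun (p : ι → ℝ × ℝ) (i : ι ⊕ ι) ↦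
      Sum.elim (fun i ↦ (p i).1) (fun i ↦ (p i).2) i :=
    measurable_pi_iff.2 (by rintro (i | i) <;> simp only [Sum.elim_inl, Sum.elim_inr] <;> fun_prop)
  have hconst : Measurable fun (z : ℝ) (_ : Unit) ↦ z := by fun_prop
  refine (hXYZ.comp hpair hconst).congr (.of_forall fun ω ↦ funext fun i ↦ ?_) (.refl _ _)
  cases i <;> rfl

lemma exists_isGaussianSpace_of_isGaussianProcess {ι : Type*} {X : ι → Ω → ℝ}
    (hX : IsGaussianProcess X P) (h0 : ∀ i, ∫ ω, X i ω ∂P = 0) :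
    ∃ S : Submodule ℝ (Lp ℝ 2 P), IsGaussianSpace S ∧ IsClosed (S : Set (Lp ℝ 2 P)) ∧
      ∀ i, toL2 P (X i) ∈ S := by
  have hae : ∀ i, toL2 P (X i) =ᵐ[P] X i := fun i ↦ coeFn_toL2 (hX.hasGaussianLaw_eval i).memLp_two
  have hspan := isGaussianSpace_span (Y := fun i ↦ toL2 P (X i)) (hX.congr fun i ↦ (hae i).symm)
    fun i ↦ (integral_congr_ae (hae i)).trans (h0 i)
  exact ⟨_, hspan.topologicalClosure, Submodule.isClosed_topologicalClosure _,
    fun i ↦ Submodule.le_topologicalClosure _ (Submodule.subset_span (mem_range_self i))⟩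

namespace IsBrownianOn

variable {T t : ℝ} {W W₁ W₂ : ℝ → Ω → ℝ}

lemma inner_toL2_eq_zero (hW : IsBrownianOn P T W) (ht : t ∈ Icc 0 T) (hX : MemLp X 2 P)
    (h : IndepFun (W t) X P) : inner ℝ (toL2 P (W t)) (toL2 P X) = 0 :=
  inner_toL2_eq_zero_of_indepFun (hW.memLp_two ht) hX h (hW.integral_eval ht)

lemma exists_isGaussianSpace (hW₁ : IsBrownianOn P T W₁) (hW₂ : IsBrownianOn P T W₂)
    (hW : IndepFun (fun ω (t : Icc 0 T) ↦ W₁ t ω) (fun ω (t : Icc 0 T) ↦ W₂ t ω) P)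
    (hZ : HasGaussianLaw Z P) (hZ0 : ∫ ω, Z ω ∂P = 0)
    (hWZ : IndepFun (fun ω (t : Icc 0 T) ↦ (W₁ t ω, W₂ t ω)) Z P) :
    ∃ S : Submodule ℝ (Lp ℝ 2 P), IsGaussianSpace S ∧ IsClosed (S : Set (Lp ℝ 2 P)) ∧
      (∀ t ∈ Icc 0 T, toL2 P (W₁ t) ∈ S) ∧ (∀ t ∈ Icc 0 T, toL2 P (W₂ t) ∈ S) ∧ toL2 P Z ∈ S := by
  obtain ⟨S, hS, hSc, hmem⟩ := exists_isGaussianSpace_of_isGaussianProcess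
    (isGaussianProcess_sumElim_const hW₁.isGaussianProcess hW₂.isGaussianProcess hW hZ hWZ)
    (by rintro ((t | t) | _); exacts [hW₁.integral_eval t.2, hW₂.integral_eval t.2, hZ0])
  exact ⟨S, hS, hSc, fun t ht ↦ hmem (.inl (.inl ⟨t, ht⟩)),
    fun t ht ↦ hmem (.inl (.inr ⟨t, ht⟩)), hmem (.inr ())⟩

end IsBrownianOn

lemma IsGaussianSpace.variance_eq_norm_sq {S : Submodule ℝ (Lp ℝ 2 P)} (hS : IsGaussianSpace S)
    (hX : MemLp X 2 P) (hXS : toL2 P X ∈ S) : Var[X; P] = ‖toL2 P X‖ ^ 2 := by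
  rw [norm_sq_eq_variance (hS.integral_eq_zero hXS), variance_congr (coeFn_toL2 hX)]

end GaussianData

/-- The process `V` is `V 0 + ∫₀ᵗ σ dW` on `[0, T]`, where `W` is a Brownian motion that is
uncorrelated with `V 0`. -/
structure IsWienerIntegralProcess {Ω : Type*} [MeasurableSpace Ω] (P : Measure Ω) (T : ℝ)
    (W : ℝ → Ω → ℝ) (σ : ℝ → ℝ) (V : ℝ → Ω → ℝ) : Prop where
  isBrownianOn : IsBrownianOn P T W
  memLp_integrand : MemLp σ 2 (volume.restrict (Ioc 0 T))
  memLp_zero : MemLp (V 0) 2 P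
  orthogonal_zero : ∀ t ∈ Icc 0 T, inner ℝ (toL2 P (W t)) (toL2 P (V 0)) = 0
  isWienerIntegral : ∀ t ∈ Icc 0 T, IsWienerIntegral P W σ t (fun ω ↦ V t ω - V 0 ω)

namespace IsWienerIntegralProcess

variable {Ω : Type*} [MeasurableSpace Ω] {P : Measure Ω} {T s t : ℝ} {W W' V : ℝ → Ω → ℝ}
  {σ v : ℝ → ℝ}

lemma memLp (hV : IsWienerIntegralProcess P T W σ V) (ht : t ∈ Icc 0 T) : MemLp (V t) 2 P := by
  simpa [Pi.add_def] using (hV.isWienerIntegral t ht).1.add hV.memLp_zero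

lemma toL2_eq_add (hV : IsWienerIntegralProcess P T W σ V) (ht : t ∈ Icc 0 T) :
    toL2 P (V t) = toL2 P (fun ω ↦ V t ω - V 0 ω) + toL2 P (V 0) := by
  refine Lp.ext ?_
  filter_upwards [coeFn_toL2 (hV.memLp ht), coeFn_toL2 (hV.isWienerIntegral t ht).1,
    coeFn_toL2 hV.memLp_zero, Lp.coeFn_add (toL2 P fun ω ↦ V t ω - V 0 ω) (toL2 P (V 0))]
    with ω ht hsub h0 hadd
  rw [hadd, Pi.add_apply, ht, hsub, h0, sub_add_cancel]

lemma toL2_mem (hV : IsWienerIntegralProcess P T W σ V) {S : Submodule ℝ (Lp ℝ 2 P)}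
    (hS : IsClosed (S : Set (Lp ℝ 2 P))) (hWS : ∀ a ∈ Icc 0 T, toL2 P (W a) ∈ S)
    (h0 : toL2 P (V 0) ∈ S) (ht : t ∈ Icc 0 T) : toL2 P (V t) ∈ S := by
  rw [hV.toL2_eq_add ht]
  exact S.add_mem ((hV.isWienerIntegral t ht).toL2_mem hV.memLp_integrand
    (fun a ↦ hV.isBrownianOn.memLp_two) ht.2 hS hWS) h0

lemma inner_toL2 (hV : IsWienerIntegralProcess P T W σ V) (hs : s ∈ Icc 0 T) (ht : t ∈ Icc 0 T) :
    inner ℝ (toL2 P (V s)) (toL2 P (V t)) =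
      ‖toL2 P (V 0)‖ ^ 2 + ∫ r in (0 : ℝ)..min s t, σ r ^ 2 := by
  have horth : ∀ r ∈ Icc 0 T, inner ℝ (toL2 P (V 0)) (toL2 P fun ω ↦ V r ω - V 0 ω) = 0 :=
    fun r hr ↦ Submodule.mem_orthogonal_singleton_iff_inner_right.1 <|
      (hV.isWienerIntegral r hr).toL2_mem hV.memLp_integrand (fun a ↦ hV.isBrownianOn.memLp_two)
        hr.2 (Submodule.isClosed_orthogonal _) fun a ha ↦
          Submodule.mem_orthogonal_singleton_iff_inner_left.2 (hV.orthogonal_zero a ha)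
  rw [hV.toL2_eq_add hs, hV.toL2_eq_add ht, inner_add_left, inner_add_right, inner_add_right,
    (hV.isWienerIntegral s hs).inner_toL2 (hV.isWienerIntegral t ht) hV.isBrownianOn
      hV.memLp_integrand hs ht, real_inner_comm, horth s hs, horth t ht,
    real_inner_self_eq_norm_sq]
  ring

lemma norm_sq_toL2 (hV : IsWienerIntegralProcess P T W σ V) (ht : t ∈ Icc 0 T) :
    ‖toL2 P (V t)‖ ^ 2 = ‖toL2 P (V 0)‖ ^ 2 + ∫ r in (0 : ℝ)..t, σ r ^ 2 := by
  rw [← real_inner_self_eq_norm_sq, hV.inner_toL2 ht ht, min_self]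

lemma hasOrthogonalIncrements (hV : IsWienerIntegralProcess P T W σ V) :
    HasOrthogonalIncrements T (fun t ↦ ‖toL2 P (V t)‖ ^ 2) fun t ↦ toL2 P (V t) :=
  fun s hs t ht hst ↦ by simp only [hV.inner_toL2 hs ht, min_eq_left hst, hV.norm_sq_toL2 hs]

lemma intervalIntegrable_sq (hV : IsWienerIntegralProcess P T W σ V) (ht : t ∈ Icc 0 T) :
    IntervalIntegrable (fun r ↦ σ r ^ 2) volume 0 t :=
  (intervalIntegrable_iff_integrableOn_Ioc_of_le ht.1).2
    (IntegrableOn.mono_set hV.memLp_integrand.integrable_sq (Ioc_subset_Ioc_right ht.2))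

lemma continuousOn_norm_sq (hV : IsWienerIntegralProcess P T W σ V) :
    ContinuousOn (fun t ↦ ‖toL2 P (V t)‖ ^ 2) (Icc 0 T) := by
  have hint := intervalIntegral.continuousOn_primitive
    ((integrableOn_Icc_iff_integrableOn_Ioc).2 hV.memLp_integrand.integrable_sq)
  refine (hint.const_add (‖toL2 P (V 0)‖ ^ 2)).congr fun t ht ↦ ?_
  rw [hV.norm_sq_toL2 ht, intervalIntegral.integral_of_le ht.1]

lemma monotoneOn_norm_sq (hV : IsWienerIntegralProcess P T W σ V) :
    MonotoneOn (fun t ↦ ‖toL2 P (V t)‖ ^ 2) (Icc 0 T) := fun s hs t ht hst ↦ by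
  simp only [hV.norm_sq_toL2 hs, hV.norm_sq_toL2 ht]
  exact add_le_add_right (intervalIntegral.integral_mono_interval le_rfl hs.1 hst
    (.of_forall fun r ↦ sq_nonneg (σ r)) (hV.intervalIntegrable_sq ht)) _

lemma isBridgeRate (hV : IsWienerIntegralProcess P T W σ V) (hT : 0 < T)
    (hv : EqOn v (fun t ↦ ‖toL2 P (V t)‖ ^ 2) (Icc 0 T)) (hvT : v T = T)
    (hint : ∀ t ∈ Ico 0 T, ∫⁻ s in Ioc 0 t, ‖v s - s‖ₑ⁻¹ ≠ ⊤) :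
    IsBridgeRate T (fun t ↦ v t - t) :=
  .of_monotoneOn_add_id hT
    (((hV.continuousOn_norm_sq.congr hv).mono Ioo_subset_Icc_self).sub continuousOn_id)
    (by simpa only [sub_add_cancel] using hV.monotoneOn_norm_sq.congr hv.symm)
    (by simpa only [sub_zero, hv (left_mem_Icc.2 hT.le)] using sq_nonneg _)
    (sub_eq_zero.2 hvT) hint

lemma isBridgePair (hV : IsWienerIntegralProcess P T W σ V) (hT : 0 < T)
    (hv : EqOn v (fun t ↦ ‖toL2 P (V t)‖ ^ 2) (Icc 0 T)) (hvT : v T = T)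
    (hint : ∀ t ∈ Ico 0 T, ∫⁻ s in Ioc 0 t, ‖v s - s‖ₑ⁻¹ ≠ ⊤) (hW' : IsBrownianOn P T W')
    (hWW' : ∀ s ∈ Icc 0 T, ∀ t ∈ Icc 0 T, inner ℝ (toL2 P (W s)) (toL2 P (W' t)) = 0)
    (hW'V : ∀ t ∈ Icc 0 T, inner ℝ (toL2 P (W' t)) (toL2 P (V 0)) = 0) :
    IsBridgePair T v (fun t ↦ toL2 P (W' t)) fun t ↦ toL2 P (V t) where
  rate := hV.isBridgeRate hT hv hvT hint
  cont := hV.continuousOn_norm_sq.congr hv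
  eq_end := hvT
  left s hs t ht hst := by rw [hW'.inner_toL2_eval hs ht, min_eq_left hst, id]
  right s hs t ht hst := by rw [hV.hasOrthogonalIncrements s hs t ht hst, hv hs]
  orthogonal s hs t ht := Submodule.mem_orthogonal_singleton_iff_inner_right.1 <|
    hV.toL2_mem (Submodule.isClosed_orthogonal _)
      (fun a ha ↦ Submodule.mem_orthogonal_singleton_iff_inner_left.2 (hWW' a ha s hs))
      (Submodule.mem_orthogonal_singleton_iff_inner_right.2 (hW'V s hs)) ht

end IsWienerIntegralProcess

section Solution

variable {Ω : Type*} [MeasurableSpace Ω] {P : Measure Ω} {T : ℝ} {v : ℝ → ℝ} {W V B : ℝ → Ω → ℝ}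

lemma IsBridgePair.isBrownianOn {S : Submodule ℝ (Lp ℝ 2 P)} (hS : IsGaussianSpace S)
    (hSc : IsClosed (S : Set (Lp ℝ 2 P)))
    (hp : IsBridgePair T v (fun t ↦ toL2 P (W t)) fun t ↦ toL2 P (V t))
    (hWS : ∀ t ∈ Icc 0 T, toL2 P (W t) ∈ S) (hVS : ∀ t ∈ Icc 0 T, toL2 P (V t) ∈ S)
    (hW : ∀ t ∈ Icc 0 T, MemLp (W t) 2 P) (hV : ∀ t ∈ Icc 0 T, MemLp (V t) 2 P)
    (hWc : ∀ᵐ ω ∂P, ContinuousOn (fun t ↦ W t ω) (Icc 0 T))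
    (hVc : ∀ᵐ ω ∂P, ContinuousOn (fun t ↦ V t ω) (Icc 0 T))
    (hB : ∀ᵐ ω ∂P, EqOn (fun t ↦ B t ω)
      (bridge T (fun t ↦ v t - t) (fun t ↦ W t ω) fun t ↦ V t ω) (Icc 0 T)) :
    IsBrownianOn P T B where
  hasLaw I hI := by
    have hmem : ∀ t : I, ((t : NNReal) : ℝ) ∈ Icc 0 T := fun t ↦ ⟨NNReal.coe_nonneg _, hI t t.2⟩
    have hw := hp.left.continuousOn continuousOn_id
    have hx := hp.right.continuousOn hp.cont
    refine (hS.hasLaw_projectiveFamily I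
      (fun t ↦ hp.rate.bridge_mem hSc hw hx hWS hVS (hmem t)) fun s t hst ↦
        hp.hasOrthogonalIncrements_bridge _ (hmem s) _ (hmem t) hst).congr ?_
    filter_upwards [hB, ae_all_iff.2 fun t : I ↦ hp.rate.coeFn_bridge hw hx
      (fun t ht ↦ coeFn_toL2 (hW t ht)) (fun t ht ↦ coeFn_toL2 (hV t ht)) hWc hVc (hmem t)]
      with ω hBω hbridge
    exact funext fun t ↦ (hBω (hmem t)).trans (hbridge t).symm
  cont := by
    filter_upwards [hB, hWc, hVc] with ω hBω hWω hVω
    exact (hp.rate.continuousOn_bridge hWω hVω).congr hBω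

lemma IsSolution.iff_eqOn_bridge (H : IsBridgeRate T (fun t ↦ Var[V t; P] - t))
    (hWc : ∀ᵐ ω ∂P, ContinuousOn (fun t ↦ W t ω) (Icc 0 T))
    (hVc : ∀ᵐ ω ∂P, ContinuousOn (fun t ↦ V t ω) (Icc 0 T)) :
    IsSolution P T V W B ↔ ∀ᵐ ω ∂P, EqOn (fun t ↦ B t ω)
      (bridge T (fun t ↦ Var[V t; P] - t) (fun t ↦ W t ω) fun t ↦ V t ω) (Icc 0 T) := by
  refine eventually_congr ?_
  filter_upwards [hWc, hVc] with ω hWω hVω using IsSolutionPath.iff_eqOn_bridge H hWω hVω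

end Solution

theorem mainTheorem4 {Ω : Type*} [MeasurableSpace Ω] (P : Measure Ω) [IsProbabilityMeasure P]
    (T : ℝ) (hT : 0 < T) (W₁ W₂ V : ℝ → Ω → ℝ) (σ : ℝ → ℝ) (v₀ : NNReal)
    -- `(W₁, W₂)` is a two-dimensional Brownian motion on `[0, T]`, independent of `V₀`
    (hW₁ : IsBrownianOn P T W₁) (hW₂ : IsBrownianOn P T W₂)
    (hW : IndepFun (fun ω (t : Icc (0 : ℝ) T) ↦ W₁ t ω) (fun ω (t : Icc (0 : ℝ) T) ↦ W₂ t ω) P)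
    (hWV : IndepFun (fun ω (t : Icc (0 : ℝ) T) ↦ (W₁ t ω, W₂ t ω)) (V 0) P)
    -- `V₀` is centred normal and `V_t = V₀ + ∫₀ᵗ σ_s dW₁_s`, with continuous paths
    (hV₀ : HasLaw (V 0) (gaussianReal 0 v₀) P)
    (hσ : MemLp σ 2 (volume.restrict (Ioc 0 T)))
    (hV : ∀ t ∈ Icc 0 T, IsWienerIntegral P W₁ σ t (fun ω ↦ V t ω - V 0 ω))
    (hVc : ∀ᵐ ω ∂P, ContinuousOn (fun t ↦ V t ω) (Icc 0 T))
    (hVT : Var[V T; P] = T)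
    -- integrability of `1 / (Var(V_s) - s)` on `[0, t]`, with `1 / 0 = ∞`
    (hint : ∀ t ∈ Ico 0 T, ∫⁻ s in Ioc 0 t, ‖Var[V s; P] - s‖ₑ⁻¹ < ⊤) :
    (∃ B : ℝ → Ω → ℝ, IsSolution P T V W₂ B) ∧
    (∀ B B' : ℝ → Ω → ℝ, IsSolution P T V W₂ B → IsSolution P T V W₂ B' →
      ∀ᵐ ω ∂P, ∀ t ∈ Icc 0 T, B t ω = B' t ω) ∧
    (∀ B : ℝ → Ω → ℝ, IsSolution P T V W₂ B →
      IsBrownianOn P T B ∧ B T =ᵐ[P] V T) := by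
  have hV₀' := hV₀.hasGaussianLaw.memLp_two
  obtain ⟨S, hS, hSc, hW₁S, hW₂S, hV₀S⟩ := hW₁.exists_isGaussianSpace hW₂ hW hV₀.hasGaussianLaw
    (hV₀.integral_eq.trans integral_id_gaussianReal) hWV
  have hproc : IsWienerIntegralProcess P T W₁ σ V := ⟨hW₁, hσ, hV₀', fun t ht ↦
    hW₁.inner_toL2_eq_zero ht hV₀' (hWV.comp
      (measurable_fst.comp (measurable_pi_apply (⟨t, ht⟩ : Icc 0 T))) measurable_id), hV⟩
  have hVS : ∀ t ∈ Icc 0 T, toL2 P (V t) ∈ S := fun t ↦ hproc.toL2_mem hSc hW₁S hV₀S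
  have hp := hproc.isBridgePair hT
    (fun t ht ↦ hS.variance_eq_norm_sq (hproc.memLp ht) (hVS t ht)) hVT
    (fun t ht ↦ (hint t ht).ne) hW₂
    (fun s hs t ht ↦ hW₁.inner_toL2_eq_zero hs (hW₂.memLp_two ht) (hW.comp
      (measurable_pi_apply (⟨s, hs⟩ : Icc 0 T)) (measurable_pi_apply (⟨t, ht⟩ : Icc 0 T))))
    fun t ht ↦ hW₂.inner_toL2_eq_zero ht hV₀' (hWV.comp
      (measurable_snd.comp (measurable_pi_apply (⟨t, ht⟩ : Icc 0 T))) measurable_id)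
  simp only [IsSolution.iff_eqOn_bridge hp.rate hW₂.cont hVc]
  refine ⟨⟨_, .of_forall fun ω ↦ eqOn_refl _ _⟩, fun B B' hB hB' ↦ ?_, fun B hB ↦ ⟨?_, ?_⟩⟩
  · filter_upwards [hB, hB'] with ω hBω hBω' using hBω.trans hBω'.symm
  · exact hp.isBrownianOn hS hSc hW₂S hVS (fun t ↦ hW₂.memLp_two) (fun t ↦ hproc.memLp)
      hW₂.cont hVc hB
  · filter_upwards [hB] with ω hBω using (hBω (right_mem_Icc.2 hT.le)).trans bridge_self
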